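/- Let $G=(V,E)$ be a finite directed acyclic graph. For $v\in V$ let $\mathrm{pa}(v)$ be the set of parents of $v$, let $\mathrm{de}(v)$ be the set of descendants of $v$ (the vertices $w\ne v$ reachable from $v$ by a directed path), and put $\overline{\mathrm{de}}(v)=\{v\}\cup\mathrm{de}(v)$. A path is a sequence of distinct vertices in which consecutive vertices are adjacent (in either direction); an interior vertex $k$ of a path is a collider if the path passes through it as $a\to k\leftarrow b$, and all other vertices of the path, including its end points, are non-colliders. A set $C\subseteq V$ d-separates $i$ and $j$ in $G$ if every path from $i$ to $j$ contains a non-collider that belongs to $C$, or a collider that does not belong to $C$ and has no descendant in $C$. For $\Omega=\mathrm{diag}(\omega_v)_{v\in V}$ with all $\omega_v>0$ and $\Lambda=(\lambda_{uv})\in\mathbb R^{V\times V}$ with $\lambda_{uv}=0$ whenever $uv\notin E$, let $$\Sigma=\phi_G(\Omega,\Lambda)=(I-\Lambda)^{-T}\,\Omega\,(I-\Lambda)^{-1}$$ be the corresponding covariance matrix in the Gaussian DAG model of $G$. Below, "for all parameters" means for all such $(\Omega,\Lambda)$, with $\Sigma=\phi_G(\Omega,\Lambda)$. For $A\subseteq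 V$ define $$\omega_{i|A}(\Sigma)=\frac{|\Sigma_{A\cup\{i\}}|}{|\Sigma_A|},\qquad \lambda_{ij|A}(\Sigma)=\frac{|\Sigma_{ij|A\setminus\{i\}}|}{|\Sigma_A|},$$ where $|\Sigma_A|$ is the principal minor on $A$, and $|\Sigma_{ij|K}|$ is the determinant of the matrix with rows $i,K$ and columns $j,K$, the elements of $K$ being listed in the same order in both (so it is $0$ if $j\in K$, because a column is repeated). Then for all $i,j\in V$ and $A\subseteq V$: 1. $\omega_i=\omega_{i|A}(\Sigma)$ for all parameters if and only if $\mathrm{pa}(i)\subseteq A\subseteq V\setminus\overline{\mathrm{de}}(i)$. 2. If $ij\notin E$, then $\lambda_{ij}=0=\lambda_{ij|A}(\Sigma)$ for all parameters if and only if $A\setminus\{i\}$ d-separates $i$ and $j$ in $G$. 3. If $ij\in E$, then $\lambda_{ij}=\lambda_{ij|A}(\Sigma)$ for all parameters if and only if $i\in A\subseteq V\setminus\overline{\mathrm{de}}(j)$ and $A\setminus\{i\}$ d-separates $i$ and $j$ in the graph obtained from $G$ by deleting the edge $ij$ and the vertices $\mathrm{de}(j)$. -/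

import Mathlib

open Matrix

namespace GaussianDAG

section Graph

variable {V : Type*}

/-- A directed graph is a DAG if it has no directed cycle (in particular no loop). -/
def IsDAG (G : Digraph V) : Prop :=
  ∀ v, ¬ Relation.TransGen G.Adj v v

/-- The parents of `i`. -/
def pa (G : Digraph V) (i : V) : Set V :=
  {k | G.Adj k i}

/-- The descendants of `i`: vertices reached from `i` by a directed path with at least one edge. -/
def de (G : Digraph V) (i : V) : Set V :=
  {k | Relation.TransGen G.Adj i k}

/-- The closure of the descendants of `i`, that is `{i} ∪ de i`. -/
def deBar (G : Digraph V) (i : V) : Set V :=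
  {i} ∪ de G i

/-- `p` is a path from `i` to `j`: a sequence of distinct vertices, starting in `i` and ending
in `j`, whose consecutive members are joined by an edge in either direction. -/
structure IsPath (G : Digraph V) (i j : V) (p : List V) : Prop where
  nodup : p.Nodup
  chain : p.IsChain (fun a b => G.Adj a b ∨ G.Adj b a)
  head : p.head? = some i
  last : p.getLast? = some j

/-- `k` is a collider within the path `p`: the path passes through consecutive vertices
`a, k, b` with `a → k ← b`. -/
def IsCollider (G : Digraph V) (p : List V) (k : V) : Prop :=
  ∃ a b, [a, k, b] <:+: p ∧ G.Adj a k ∧ G.Adj b k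

/-- The path `p` is blocked by `C`: it contains a non-collider that belongs to `C`, or a collider
that does not belong to `C` and has no descendant in `C`. -/
def IsBlocked (G : Digraph V) (C : Set V) (p : List V) : Prop :=
  ∃ k ∈ p, (¬ IsCollider G p k ∧ k ∈ C) ∨ (IsCollider G p k ∧ k ∉ C ∧ ∀ d ∈ de G k, d ∉ C)

/-- `C` d-separates `A` and `B` in `G`: every path from a vertex of `A` to a vertex of `B` is
blocked by `C`. (The end points of a path are non-colliders.) -/
def DSeparates (G : Digraph V) (C A B : Set V) : Prop :=
  ∀ i ∈ A, ∀ j ∈ B, ∀ p, IsPath G i j p → IsBlocked G C p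

/-- The graph that arises from `G` by deleting the edge `i → j` and the vertices `de j`;
its vertices are the vertices of `G` outside `de j`. -/
def edgeDeleted (G : Digraph V) (i j : V) : Digraph {v : V // v ∉ de G j} where
  Adj a b := G.Adj a b ∧ ¬ ((a : V) = i ∧ (b : V) = j)

theorem self_notMem_de {G : Digraph V} (hG : IsDAG G) (j : V) : j ∉ de G j :=
  hG j

theorem tail_notMem_de {G : Digraph V} (hG : IsDAG G) {i j : V} (h : G.Adj i j) : i ∉ de G j :=
  fun hi => hG j (hi.tail h)

end Graph

section Model

variable {V : Type*} [Fintype V] [DecidableEq V]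

/-- `(ω, Λ)` is a parameter of the Gaussian DAG model of `G`: the error variances are positive
and `Λ` is supported on the edges of `G`. -/
structure IsParam (G : Digraph V) (ω : V → ℝ) (Λ : Matrix V V ℝ) : Prop where
  pos : ∀ i, 0 < ω i
  supp : ∀ i j, ¬ G.Adj i j → Λ i j = 0

/-- The covariance matrix `(1 - Λ)⁻ᵀ Ω (1 - Λ)⁻¹` with `Ω = diag ω`. -/
noncomputable def phi (ω : V → ℝ) (Λ : Matrix V V ℝ) : Matrix V V ℝ :=
  ((1 - Λ)⁻¹)ᵀ * diagonal ω * (1 - Λ)⁻¹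

/-- The principal minor `|Σ_A|`. -/
noncomputable def principalMinor (S : Matrix V V ℝ) (A : Finset V) : ℝ :=
  (S.submatrix (fun a : A => (a : V)) (fun a : A => (a : V))).det

/-- The almost-principal minor `|Σ_{ij|K}|`: rows `i, K` and columns `j, K`, listed in such a way
that row `i` corresponds to column `j` and row `k` to column `k` for `k ∈ K`. -/
noncomputable def almostPrincipalMinor (S : Matrix V V ℝ) (i j : V) (K : Finset V) : ℝ :=
  (S.submatrix (Sum.elim (fun _ : Unit => i) (fun k : K => (k : V)))
    (Sum.elim (fun _ : Unit => j) (fun k : K => (k : V)))).det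

/-- The rational function `ω_{i|A}(Σ) = |Σ_{iA}| / |Σ_A|`. -/
noncomputable def omegaFun (i : V) (A : Finset V) (S : Matrix V V ℝ) : ℝ :=
  principalMinor S (insert i A) / principalMinor S A

/-- The rational function `λ_{ij|A}(Σ) = |Σ_{ij|A∖i}| / |Σ_A|`. -/
noncomputable def lambdaFun (i j : V) (A : Finset V) (S : Matrix V V ℝ) : ℝ :=
  almostPrincipalMinor S i j (A.erase i) / principalMinor S A

end Model

end GaussianDAG

/-! Everything is read off the conditional covariance σ_{ij|K} = |Σ_{ij|K}| / |Σ_K| (`condCov`), the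
covariance of the residual of i, after regression on K, with j. For i ∉ A, ω_{i|A} is σ_{ii|A}; for
i ∈ A, λ_{ij|A} is σ_{ij|A∖i} / σ_{ii|A∖i}, the coefficient of i in the regression of j on A.

The core is `dep_iff_conn`: σ_{ij|K} vanishes on the whole model exactly when i and j are
d-separated. Since d-separation quantifies over paths, which do not behave well under local changes,
it is first replaced by the Bayes ball, a walk with local rules (`dSeparates_iff_not_conn`). Then
connection by the ball and non-vanishing of σ_{ij|K} are shown to obey the same recursion when a
sink s is stripped of its edges. If s is neither an end point nor in K, it is irrelevant. If s ∉ K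
is an end point, it is replaced by one of its parents; algebraically this is the structural equation
of s. If s ∈ K, a ball may enter s from one parent and bounce to another; algebraically this is
σ_{ij|K∪s} = σ_{ij|K} − σ_{is|K} σ_{sj|K} / σ_{ss|K}. In the last case two factors must be non-zero
for the same parameters, which `exists_condCov_ne_zero` provides.

This settles the non-edge case. In the vertex case, the structural equation of i is its regression
on A when A contains the parents and no vertex of `deBar G i`. In the edge case, for A outside
`deBar G j`, removing the term of i from the structural equation of j leaves the model of the
edge-deleted graph, so that λ_{ij|A} − λ_{ij} = σ'_{ij|A∖i} / σ_{ii|A∖i}, with σ' taken in that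
model; the core applies to it. The other conditions are necessary by explicit parameters: rescaled
error variances, a single edge from a parent, or unit coefficients along a directed path to a first
descendant in A (`exists_pathCov`). -/

set_option linter.unusedSectionVars false

namespace GaussianDAG

/-! ### The Bayes ball -/

section Graph

variable {V : Type*} {G : Digraph V} {K : Set V}

/-- The vertices that belong to `K` or have a descendant in `K`. -/
def anc (G : Digraph V) (K : Set V) : Set V :=
  {k | k ∈ K ∨ ∃ d ∈ de G k, d ∈ K}

theorem anc_of_adj {x k : V} (h : G.Adj x k) (hk : k ∈ anc G K) : x ∈ anc G K := by
  rcases hk with hk | ⟨d, hd, hdK⟩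
  · exact Or.inr ⟨k, .single h, hk⟩
  · exact Or.inr ⟨d, .head h hd, hdK⟩

theorem IsDAG.asymm (hG : IsDAG G) {a b : V} (h : G.Adj a b) : ¬ G.Adj b a :=
  fun h' => hG a ((Relation.TransGen.single h).tail h')

theorem IsDAG.ne (hG : IsDAG G) {a b : V} (h : G.Adj a b) : a ≠ b := by
  rintro rfl
  exact hG a (.single h)

/-- Reachability of the Bayes ball started in `i`, given `K`. The flag tells whether `v` was
entered against an arrow (from a child, or as the start), or along an arrow (from a parent). -/
inductive Ball (G : Digraph V) (K : Set V) (i : V) : V → Bool → Prop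
  | start : Ball G K i i true
  | child {v w : V} {d : Bool} : Ball G K i v d → v ∉ K → G.Adj v w → Ball G K i w false
  | parent {v u : V} {d : Bool} : Ball G K i v d → (d = true ↔ v ∉ K) → G.Adj u v →
      Ball G K i u true

theorem Ball.trans {i b v : V} {d : Bool} (h : Ball G K i b true) (h' : Ball G K b v d) :
    Ball G K i v d := by
  induction h' with
  | start => exact h
  | child _ hv hw ih => exact ih.child hv hw
  | parent _ hv hw ih => exact ih.parent hv hw

/-- Neither rule applies at a start in K, so the ball is stuck. Hence a ball that reaches a vertex
outside K also started outside K. -/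
theorem Ball.eq_of_mem {b v : V} {d : Bool} (hb : b ∈ K) (h : Ball G K b v d) :
    v = b ∧ d = true := by
  induction h with
  | start => exact ⟨rfl, rfl⟩
  | child _ hv _ ih => exact absurd (ih.1 ▸ hb) hv
  | parent _ hv _ ih => exact absurd (ih.1 ▸ hb) (hv.1 ih.2)

/-- A ball that enters `k` along an arrow returns to it, if `k` has a descendant in `K`. -/
theorem Ball.bounce {i k e : V} (hke : Relation.TransGen G.Adj k e) (he : e ∈ K)
    (h : Ball G K i k false) (hk : k ∉ K) : Ball G K i k true := by
  -- The ball runs down the directed path to its first vertex in K below k, bounces there and climbs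
  -- back the same way.
  induction hke using Relation.TransGen.head_induction_on with
  | single hadj => exact (h.child hk hadj).parent (by simp [he]) hadj
  | @head a c hadj _ ih =>
    have h1 := h.child hk hadj
    by_cases hc : c ∈ K
    · exact h1.parent (by simp [hc]) hadj
    · exact (ih h1 hc).parent (by simp [hc]) hadj

/-! ### Active paths, and d-separation in terms of the Bayes ball -/

/-- Every interior vertex of `p` lets the path pass, given `K`. -/
def IsActive (G : Digraph V) (K : Set V) (p : List V) : Prop :=
  ∀ a k b, [a, k, b] <:+: p →
    (G.Adj a k ∧ G.Adj b k → k ∈ anc G K) ∧ (¬ (G.Adj a k ∧ G.Adj b k) → k ∉ K)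

theorem IsActive.of_suffix {p q : List V} (h : IsActive G K p) (hq : q <:+ p) :
    IsActive G K q :=
  fun a k b hi => h a k b (hi.trans hq.isInfix)

theorem isActive_singleton (j : V) : IsActive G K [j] := by
  intro a k b h
  have := h.length_le
  simp at this

theorem isActive_pair (i j : V) : IsActive G K [i, j] := by
  intro a k b h
  have := h.length_le
  simp at this

theorem isActive_cons_cons_cons {x v y : V} {r : List V}
    (h1 : (G.Adj x v ∧ G.Adj y v → v ∈ anc G K) ∧ (¬ (G.Adj x v ∧ G.Adj y v) → v ∉ K))
    (h : IsActive G K (v :: y :: r)) : IsActive G K (x :: v :: y :: r) := by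
  intro a k b hi
  rw [List.infix_cons_iff] at hi
  rcases hi with hi | hi
  · simp only [List.cons_prefix_cons] at hi
    obtain ⟨rfl, rfl, rfl, -⟩ := hi
    exact h1
  · exact h a k b hi

/-- In a list without repetition, a vertex has at most one pair of neighbours. -/
theorem triple_unique {p : List V} (hp : p.Nodup) {a k b a' b' : V}
    (h : [a, k, b] <:+: p) (h' : [a', k, b'] <:+: p) : a = a' ∧ b = b' := by
  obtain ⟨s, t, hs⟩ := h
  obtain ⟨s', t', hs'⟩ := h'
  have e : (s ++ [a]) ++ k :: (b :: t) = (s' ++ [a']) ++ k :: (b' :: t') := by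
    simpa using hs.trans hs'.symm
  have hn : ((s ++ [a]) ++ k :: (b :: t)).Nodup := by
    have : (s ++ [a]) ++ k :: (b :: t) = p := by simpa using hs
    rw [this]; exact hp
  have hn' : ((s' ++ [a']) ++ k :: (b' :: t')).Nodup := e ▸ hn
  have h1 : k ∉ s ++ [a] := fun hk =>
    (List.disjoint_of_nodup_append hn) hk (by simp)
  have h2 : k ∉ s' ++ [a'] := fun hk =>
    (List.disjoint_of_nodup_append hn') hk (by simp)
  -- Neither prefix contains k, so both have the index of k as their length.
  obtain ⟨e1, e2⟩ := (List.append_inj e) (by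
    classical
    have q1 := List.idxOf_append_of_notMem (l₂ := k :: (b :: t)) h1
    have q2 := List.idxOf_append_of_notMem (l₂ := k :: (b' :: t')) h2
    rw [e, q2] at q1
    simpa using q1.symm)
  simp only [List.append_singleton_inj] at e1
  simp only [List.cons.injEq] at e2
  exact ⟨e1.2, e2.2.1⟩

theorem not_isCollider_last {x : V} {l : List V} (hp : (l ++ [x]).Nodup) :
    ¬ IsCollider G (l ++ [x]) x := by
  rintro ⟨a, b, ⟨s, t, h⟩, -⟩
  have hx : x ∉ l := fun hx => (List.disjoint_of_nodup_append hp) hx (by simp)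
  rcases List.eq_nil_or_concat t with rfl | ⟨t', c, rfl⟩
  · have e : (s ++ [a, x]) ++ [b] = l ++ [x] := by simpa using h
    rw [List.append_singleton_inj] at e
    exact hx (e.1 ▸ by simp)
  · have e : (s ++ [a, x, b] ++ t') ++ [c] = l ++ [x] := by simpa using h
    rw [List.append_singleton_inj] at e
    exact hx (e.1 ▸ by simp)

theorem IsPath.exists_cons {i j : V} {p : List V} (h : IsPath G i j p) : ∃ l, p = i :: l := by
  have := h.head
  cases p with
  | nil => simp at this
  | cons a l => simp at this; exact ⟨l, by rw [this]⟩

theorem IsPath.exists_concat {i j : V} {p : List V} (h : IsPath G i j p) :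
    ∃ l, p = l ++ [j] := by
  have h1 := h.last
  rw [List.getLast?_eq_some_iff] at h1
  exact h1

theorem IsPath.suffix {i j x : V} {s t : List V} (h : IsPath G i j (s ++ x :: t)) :
    IsPath G x j (x :: t) where
  nodup := h.nodup.of_append_right
  chain := h.chain.right_of_append
  head := rfl
  last := by simpa [List.getLast?_append] using h.last

theorem isBlocked_of_mem {i j : V} {p : List V} (h : IsPath G i j p) (hj : j ∈ K) :
    IsBlocked G K p := by
  obtain ⟨l, rfl⟩ := h.exists_concat
  exact ⟨j, by simp, Or.inl ⟨not_isCollider_last h.nodup, hj⟩⟩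

theorem IsPath.isActive {i j : V} {p : List V} (h : IsPath G i j p) (hb : ¬ IsBlocked G K p) :
    IsActive G K p := by
  intro a k b hi
  have hk : k ∈ p := hi.subset (by simp)
  simp only [IsBlocked, not_exists, not_and, not_or] at hb
  obtain ⟨h1, h2⟩ := hb k hk
  constructor
  · intro hc
    have := h2 ⟨a, b, hi, hc⟩
    by_cases hkK : k ∈ K
    · exact Or.inl hkK
    · have := this hkK
      push Not at this
      exact Or.inr this
  · intro hc hkK
    refine h1 ?_ hkK
    rintro ⟨a', b', hi', hc'⟩
    obtain ⟨rfl, rfl⟩ := triple_unique h.nodup hi hi'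
    exact hc hc'

theorem IsPath.not_isBlocked {i j : V} {p : List V} (h : IsPath G i j p) (hi : i ∉ K)
    (hj : j ∉ K) (ha : IsActive G K p) : ¬ IsBlocked G K p := by
  rintro ⟨k, hk, ⟨hc, hkK⟩ | ⟨⟨a, b, hab, hc⟩, hkK, hd⟩⟩
  · obtain ⟨s, t, rfl⟩ := List.append_of_mem hk
    rcases List.eq_nil_or_concat s with rfl | ⟨s', a, rfl⟩
    · have := h.head
      simp at this
      exact hi (this ▸ hkK)
    · cases t with
      | nil =>
        have := h.last
        simp at this
        exact hj (this ▸ hkK)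
      | cons b t =>
        have hin : [a, k, b] <:+: s'.concat a ++ k :: b :: t := ⟨s', t, by simp⟩
        by_cases hcc : G.Adj a k ∧ G.Adj b k
        · exact hc ⟨a, b, hin, hcc⟩
        · exact (ha a k b hin).2 hcc hkK
  · rcases (ha a k b hab).1 hc with h | ⟨d, hd1, hd2⟩
    · exact hkK h
    · exact hd d hd1 hd2

/-- The ball starts at the far end j and follows the path back to x. A collider outside K but with a
descendant in K is passed by `Ball.bounce`. -/
theorem ball_of_isActive (hG : IsDAG G) {j : V} (hj : j ∉ K) :
    ∀ (l : List V) (x y : V), IsPath G x j (x :: y :: l) → IsActive G K (x :: y :: l) →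
      (G.Adj y x → Ball G K j x false) ∧ (G.Adj x y → Ball G K j x true)
  | [], x, y, hp, _ => by
    obtain rfl : y = j := by simpa using hp.last
    exact ⟨fun h => Ball.start.child hj h, fun h => Ball.start.parent (by simp [hj]) h⟩
  | z :: l, x, y, hp, ha => by
    have hp' : IsPath G y j (y :: z :: l) := IsPath.suffix (s := [x]) hp
    obtain ⟨h1, h2⟩ := ball_of_isActive hG hj l y z hp' (ha.of_suffix (by simp))
    obtain ⟨t1, t2⟩ := ha x y z ⟨[], l, by simp⟩
    have hch := hp'.chain
    rw [List.isChain_cons_cons] at hch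
    constructor
    · intro h
      have hyK : y ∉ K := t2 fun hc => hG.asymm h hc.1
      rcases hch.1 with hyz | hzy
      · exact (h2 hyz).child hyK h
      · exact (h1 hzy).child hyK h
    · intro h
      by_cases hzy : G.Adj z y
      · by_cases hy : y ∈ K
        · exact (h1 hzy).parent (by simp [hy]) h
        · rcases t1 ⟨h, hzy⟩ with hc | ⟨e, he, heK⟩
          · exact absurd hc hy
          · exact ((h1 hzy).bounce he heK hy).parent (by simp [hy]) h
      · have hyK : y ∉ K := t2 fun hc => hzy hc.2
        exact (h2 (hch.1.resolve_right hzy)).parent (by simp [hyK]) h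

/-- If a path leaves `x` backwards along an arrow out of `x`, then it continues against the
arrows up to its head, unless `x` is an ancestor of `K`. -/
theorem anc_or_of_isActive {x : V} {t : List V} :
    ∀ (s : List V) (v : V), (v :: (s ++ x :: t)).IsChain (fun a b => G.Adj a b ∨ G.Adj b a) →
      IsActive G K (v :: (s ++ x :: t)) → (∀ a ∈ (v :: s).getLast?, G.Adj x a) →
      x ∈ anc G K ∨ ((∀ a ∈ (s ++ x :: t).head?, G.Adj a v) ∧ (v ∈ anc G K → x ∈ anc G K))
  | [], v, _, _, h => Or.inr ⟨by simpa using h, anc_of_adj (by simpa using h)⟩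
  | a :: s, v, hc, ha, h => by
    have hc' := hc
    simp only [List.cons_append, List.isChain_cons_cons] at hc'
    rcases anc_or_of_isActive s a hc'.2 (ha.of_suffix (by simp)) (by simpa using h) with
      h1 | ⟨h1, h2⟩
    · exact Or.inl h1
    · rcases hc'.1 with hva | hav
      · left
        apply h2
        cases s with
        | nil => exact (ha v a x ⟨[], t, by simp⟩).1 ⟨hva, by simpa using h1⟩
        | cons b s => exact (ha v a b ⟨[], s ++ x :: t, by simp⟩).1 ⟨hva, by simpa using h1⟩
      · exact Or.inr ⟨by simpa using hav, fun hv => h2 (anc_of_adj hav hv)⟩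

/-- A ball may revisit vertices, so the path is built along its run and cut back at each repetition.
The last two clauses are the invariant that allows extension by a parent u of v: if v then becomes a
collider, it is in `anc G K`, and if v is in K, it does become one. -/
theorem exists_isActive_of_ball (hG : IsDAG G) {j v : V} {d : Bool} (hj : j ∉ K)
    (h : Ball G K j v d) :
    ∃ l, IsPath G v j (v :: l) ∧ IsActive G K (v :: l) ∧
      (d = true → v ∉ K → ∀ y ∈ l.head?, G.Adj y v → v ∈ anc G K) ∧
      (d = false → v ∈ K → ∃ y ∈ l.head?, G.Adj y v) := by
  induction h with
  | start =>
    exact ⟨[], ⟨by simp, by simp, rfl, rfl⟩, isActive_singleton _, by simp, by simp⟩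
  | @child v w d _ hv hvw ih =>
    obtain ⟨l, hp, ha, -, -⟩ := ih
    -- When w is already on the path, the path is cut back to w. If w ∈ K, it was an interior vertex
    -- of an active path, hence a collider, and the next arrow points into w.
    by_cases hw : w ∈ v :: l
    · obtain ⟨s, t, hs⟩ := List.append_of_mem hw
      rw [hs] at hp ha
      refine ⟨t, hp.suffix, ha.of_suffix (by simp), by simp, fun _ hwK => ?_⟩
      rcases List.eq_nil_or_concat s with rfl | ⟨s', a, rfl⟩
      · simp at hs
        exact absurd hs.1 (hG.ne hvw)
      · cases t with
        | nil =>
          have := hp.last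
          simp at this
          exact absurd (this ▸ hwK) hj
        | cons b t =>
          have hin : [a, w, b] <:+: s'.concat a ++ w :: b :: t := ⟨s', t, by simp⟩
          by_contra hcon
          exact (ha a w b hin).2 (fun hc => hcon ⟨b, by simp, hc.2⟩) hwK
    · refine ⟨v :: l, ⟨List.nodup_cons.2 ⟨hw, hp.nodup⟩, ?_, rfl, ?_⟩, ?_, by simp, ?_⟩
      · exact List.isChain_cons_cons.2 ⟨Or.inr hvw, hp.chain⟩
      · simpa using hp.last
      · cases l with
        | nil => exact isActive_pair _ _
        | cons y r =>
          exact isActive_cons_cons_cons ⟨fun hc => absurd hvw (hG.asymm hc.1), fun _ => hv⟩ ha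
      · exact fun _ _ => ⟨v, by simp, hvw⟩
  | @parent v u d _ hdv huv ih =>
    obtain ⟨l, hp, ha, hup, hdown⟩ := ih
    by_cases hu : u ∈ v :: l
    · obtain ⟨s, t, rfl⟩ := List.append_of_mem (List.mem_of_ne_of_mem (hG.ne huv) hu)
      refine ⟨t, IsPath.suffix (s := v :: s) hp, ha.of_suffix ⟨v :: s, by simp⟩,
        fun _ huK y hy hyu => ?_, by simp⟩
      by_cases hv : v ∈ K
      · exact anc_of_adj huv (Or.inl hv)
      obtain ⟨t, rfl⟩ : ∃ t', t = y :: t' := by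
        cases t with
        | nil => simp at hy
        | cons c t => simp at hy; exact ⟨t, by rw [hy]⟩
      obtain ⟨s', a, hs'⟩ : ∃ (s' : List V) (a : V), v :: s = s'.concat a := by
        rcases List.eq_nil_or_concat (v :: s) with h | h
        · simp at h
        · exact h
      have hin : [a, u, y] <:+: v :: (s ++ u :: y :: t) :=
        ⟨s', t, by rw [← List.cons_append, hs']; simp⟩
      by_cases hau : G.Adj a u
      · exact (ha a u y hin).1 ⟨hau, hyu⟩
      · have hua : G.Adj u a := by
          have := hp.chain.infix hin
          simp only [List.isChain_cons_cons] at this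
          exact this.1.resolve_left hau
        -- The path leaves u towards v along an arrow out of u. Either it meets a collider, which
        -- makes u an ancestor of K, or it is directed all the way into v, and the invariant at v
        -- applies.
        rcases anc_or_of_isActive s v hp.chain ha (by rw [hs']; simpa using hua) with h | ⟨h1, h2⟩
        · exact h
        · refine anc_of_adj huv ?_
          have hne : ∃ c, c ∈ (s ++ u :: y :: t).head? := by
            cases s <;> simp
          obtain ⟨c, hc⟩ := hne
          exact hup (hdv.2 hv) hv c hc (h1 c hc)
    · refine ⟨v :: l, ⟨List.nodup_cons.2 ⟨hu, hp.nodup⟩, ?_, rfl, ?_⟩, ?_, ?_, by simp⟩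
      · exact List.isChain_cons_cons.2 ⟨Or.inl huv, hp.chain⟩
      · simpa using hp.last
      · cases l with
        | nil => exact isActive_pair _ _
        | cons y r =>
          refine isActive_cons_cons_cons ⟨fun hc => ?_, fun hc hv => ?_⟩ ha
          · by_cases hv : v ∈ K
            · exact Or.inl hv
            · exact hup (hdv.2 hv) hv y (by simp) hc.2
          · have hd : d = false := by
              cases d
              · rfl
              · exact absurd hv (hdv.1 rfl)
            obtain ⟨c, hc1, hc2⟩ := hdown hd hv
            simp at hc1
            exact hc ⟨huv, hc1 ▸ hc2⟩
      · intro _ _ y hy hyu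
        simp at hy
        exact absurd huv (hG.asymm (hy ▸ hyu))

/-- `i` and `j` are outside `K`, and the Bayes ball started in `i` reaches `j` given `K`. -/
def Conn (G : Digraph V) (K : Set V) (i j : V) : Prop :=
  i ∉ K ∧ j ∉ K ∧ ∃ d, Ball G K i j d

/-- The ball is started in j, so that a path from i to j is built by adding vertices at its head. -/
theorem dSeparates_iff_not_conn (hG : IsDAG G) {i j : V} (hi : i ∉ K) :
    DSeparates G K {i} {j} ↔ ¬ Conn G K j i := by
  simp only [DSeparates, Set.mem_singleton_iff, forall_eq]
  by_cases hj : j ∈ K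
  · exact ⟨fun _ h => h.1 hj, fun _ p hp => isBlocked_of_mem hp hj⟩
  constructor
  · rintro h ⟨-, -, d, hd⟩
    obtain ⟨l, hp, ha, -⟩ := exists_isActive_of_ball hG hj hd
    exact hp.not_isBlocked hi hj ha (h _ hp)
  · intro h p hp
    by_contra hb
    have ha := hp.isActive hb
    obtain ⟨l, rfl⟩ := hp.exists_cons
    refine h ⟨hj, hi, ?_⟩
    cases l with
    | nil =>
      obtain rfl : i = j := by simpa using hp.last
      exact ⟨_, .start⟩
    | cons y l =>
      obtain ⟨h1, h2⟩ := ball_of_isActive hG hj l i y hp ha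
      have hch := hp.chain
      rw [List.isChain_cons_cons] at hch
      rcases hch.1 with h | h
      · exact ⟨_, h2 h⟩
      · exact ⟨_, h1 h⟩

/-! ### Removing a sink: recursion for the Bayes ball -/

/-- The graph without the edges at `s`. -/
def isolate (G : Digraph V) (s : V) : Digraph V where
  Adj a b := G.Adj a b ∧ a ≠ s ∧ b ≠ s

theorem IsDAG.mono {G' : Digraph V} (hG : IsDAG G) (h : ∀ a b, G'.Adj a b → G.Adj a b) :
    IsDAG G' :=
  fun v hv => hG v (Relation.TransGen.mono h _ _ hv)

theorem Ball.of_isolate {s i v : V} {d : Bool} {K' : Set V} (hK : ∀ v, v ≠ s → (v ∈ K' ↔ v ∈ K))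
    (h : Ball (isolate G s) K' i v d) : Ball G K i v d := by
  induction h with
  | start => exact .start
  | child _ hv hw ih => exact ih.child (by rwa [← hK _ hw.2.1]) hw.1
  | parent _ hv hw ih => exact ih.parent (by rwa [← hK _ hw.2.2]) hw.1

/-- A sink outside K is a dead end: it is entered only from a parent, has no child to move on to,
and does not bounce. -/
theorem Ball.to_isolate {s i v : V} {d : Bool} (hs : ∀ w, ¬ G.Adj s w) (hsK : s ∉ K)
    (hi : i ≠ s) (h : Ball G K i v d) :
    (v ≠ s ∧ Ball (isolate G s) K i v d) ∨
      (v = s ∧ d = false ∧ ∃ p, G.Adj p s ∧ Conn (isolate G s) K i p) := by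
  have key : ∀ {v d}, Ball (isolate G s) K i v d → v ∉ K → Conn (isolate G s) K i v := by
    intro v d hb hv
    refine ⟨fun hiK => hv ?_, hv, d, hb⟩
    rw [(Ball.eq_of_mem hiK hb).1]
    exact hiK
  induction h with
  | start => exact Or.inl ⟨hi, .start⟩
  | @child v w d _ hv hw ih =>
    rcases ih with ⟨hvs, ih⟩ | ⟨rfl, -⟩
    · by_cases hws : w = s
      · subst hws
        exact Or.inr ⟨rfl, rfl, v, hw, key ih hv⟩
      · exact Or.inl ⟨hws, ih.child hv ⟨hw, hvs, hws⟩⟩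
    · exact absurd hw (hs _)
  | @parent v u d _ hv hu ih =>
    have hus : u ≠ s := by rintro rfl; exact hs _ hu
    rcases ih with ⟨hvs, ih⟩ | ⟨rfl, rfl, -⟩
    · exact Or.inl ⟨hus, ih.parent hv ⟨hu, hus, hvs⟩⟩
    · simp [hsK] at hv

theorem conn_isolate_iff {s i j : V} (hs : ∀ w, ¬ G.Adj s w) (hsK : s ∉ K)
    (hi : i ≠ s) (hj : j ≠ s) : Conn G K i j ↔ Conn (isolate G s) K i j := by
  constructor
  · rintro ⟨h1, h2, d, hd⟩
    rcases hd.to_isolate hs hsK hi with h | h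
    · exact ⟨h1, h2, d, h.2⟩
    · exact absurd h.1 hj
  · rintro ⟨h1, h2, d, hd⟩
    exact ⟨h1, h2, d, hd.of_isolate fun _ _ => Iff.rfl⟩

theorem conn_sink_right_iff {s i : V} (hs : ∀ w, ¬ G.Adj s w) (hsK : s ∉ K)
    (hi : i ≠ s) : Conn G K i s ↔ ∃ p, G.Adj p s ∧ Conn (isolate G s) K i p := by
  constructor
  · rintro ⟨h1, h2, d, hd⟩
    rcases hd.to_isolate hs hsK hi with h | h
    · exact absurd rfl h.1
    · exact h.2.2
  · rintro ⟨p, hp, h1, h2, d, hd⟩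
    exact ⟨h1, hsK, _, (hd.of_isolate fun _ _ => Iff.rfl).child h2 hp⟩

theorem conn_sink_left_iff {s j : V} (hs : ∀ w, ¬ G.Adj s w) (hsK : s ∉ K)
    (hj : j ≠ s) : Conn G K s j ↔ ∃ p, G.Adj p s ∧ Conn (isolate G s) K p j := by
  constructor
  · rintro ⟨h1, h2, d, hd⟩
    have key : ∀ v d, Ball G K s v d →
        v = s ∨ (v ≠ s ∧ ∃ p, G.Adj p s ∧ Ball (isolate G s) K p v d) := by
      intro v d h
      induction h with
      | start => exact Or.inl rfl
      | @child v w d _ hv hw ih =>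
        rcases ih with rfl | ⟨hvs, p, hp, ih⟩
        · exact absurd hw (hs _)
        · by_cases hws : w = s
          · exact Or.inl hws
          · exact Or.inr ⟨hws, p, hp, ih.child hv ⟨hw, hvs, hws⟩⟩
      | @parent v u d _ hv hu ih =>
        have hus : u ≠ s := by rintro rfl; exact hs _ hu
        rcases ih with rfl | ⟨hvs, p, hp, ih⟩
        · exact Or.inr ⟨hus, u, hu, .start⟩
        · exact Or.inr ⟨hus, p, hp, ih.parent hv ⟨hu, hus, hvs⟩⟩
    rcases key j d hd with h | ⟨-, p, hp, h⟩
    · exact absurd h hj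
    · exact ⟨p, hp, fun hpK => h2 (by rw [(Ball.eq_of_mem hpK h).1]; exact hpK), h2, d, h⟩
  · rintro ⟨p, hp, h1, h2, d, hd⟩
    exact ⟨hsK, h2, d, (Ball.start.parent (by simp [hsK]) hp).trans
      (hd.of_isolate fun _ _ => Iff.rfl)⟩

/-- A ball visits a sink in K only by entering from a parent and bouncing to a parent. Of all
visits, it suffices to keep the first entry, from a, and the last exit, to b. -/
theorem conn_insert_sink_iff {s i j : V} (hs : ∀ w, ¬ G.Adj s w) (hsK : s ∉ K)
    (hi : i ≠ s) (hj : j ≠ s) :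
    Conn G (insert s K) i j ↔ Conn (isolate G s) K i j ∨
      ((∃ a, G.Adj a s ∧ Conn (isolate G s) K i a) ∧
        ∃ b, G.Adj b s ∧ Conn (isolate G s) K b j) := by
  have hKK : ∀ v, v ≠ s → (v ∈ K ↔ v ∈ insert s K) := fun v hv => by simp [hv]
  constructor
  · rintro ⟨h1, h2, d, hd⟩
    have hiK : i ∉ K := by rwa [hKK i hi]
    have hjK : j ∉ K := by rwa [hKK j hj]
    have key : ∀ v d, Ball G (insert s K) i v d →
        (v = s ∧ d = false ∧ ∃ a, G.Adj a s ∧ Conn (isolate G s) K i a) ∨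
        (v ≠ s ∧ (Ball (isolate G s) K i v d ∨
          ((∃ a, G.Adj a s ∧ Conn (isolate G s) K i a) ∧
            ∃ b, G.Adj b s ∧ Ball (isolate G s) K b v d))) := by
      intro v d h
      induction h with
      | start => exact Or.inr ⟨hi, Or.inl .start⟩
      | @child v w d _ hv hw ih =>
        rcases ih with ⟨rfl, -⟩ | ⟨hvs, ih⟩
        · exact absurd hw (hs _)
        rw [← hKK v hvs] at hv
        by_cases hws : w = s
        · subst hws
          refine Or.inl ⟨rfl, rfl, ?_⟩
          rcases ih with ih | ⟨h, -⟩
          · exact ⟨v, hw, hiK, hv, _, ih⟩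
          · exact h
        · refine Or.inr ⟨hws, ?_⟩
          rcases ih with ih | ⟨h, b, hb, ih⟩
          · exact Or.inl (ih.child hv ⟨hw, hvs, hws⟩)
          · exact Or.inr ⟨h, b, hb, ih.child hv ⟨hw, hvs, hws⟩⟩
      | @parent v u d _ hv hu ih =>
        have hus : u ≠ s := by rintro rfl; exact hs _ hu
        rcases ih with ⟨rfl, -, h⟩ | ⟨hvs, ih⟩
        · exact Or.inr ⟨hus, Or.inr ⟨h, u, hu, .start⟩⟩
        rw [← hKK v hvs] at hv
        refine Or.inr ⟨hus, ?_⟩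
        rcases ih with ih | ⟨h, b, hb, ih⟩
        · exact Or.inl (ih.parent hv ⟨hu, hus, hvs⟩)
        · exact Or.inr ⟨h, b, hb, ih.parent hv ⟨hu, hus, hvs⟩⟩
    rcases key j d hd with ⟨h, -⟩ | ⟨-, h | ⟨h, b, hb, h'⟩⟩
    · exact absurd h hj
    · exact Or.inl ⟨hiK, hjK, d, h⟩
    · refine Or.inr ⟨h, b, hb, fun hbK => hjK ?_, hjK, d, h'⟩
      rw [(Ball.eq_of_mem hbK h').1]
      exact hbK
  · rintro (⟨h1, h2, d, hd⟩ | ⟨⟨a, ha, h1, h2, d, hd⟩, b, hb, h3, h4, d', hd'⟩)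
    · exact ⟨by rwa [← hKK i hi], by rwa [← hKK j hj], d, hd.of_isolate hKK⟩
    · have has : a ≠ s := by rintro rfl; exact hs _ ha
      have hball := ((hd.of_isolate hKK).child (by rwa [← hKK a has]) ha).parent (by simp) hb
      exact ⟨by rwa [← hKK i hi], by rwa [← hKK j hj], d', hball.trans (hd'.of_isolate hKK)⟩

end Graph

/-! ### Conditional covariances and regression -/

section CondCov

variable {V : Type*} [Fintype V] [DecidableEq V] {S : Matrix V V ℝ} {K : Finset V} {i j : V}

/-- The conditional covariance of `i` and `j` given `K`. -/
noncomputable def condCov (S : Matrix V V ℝ) (K : Finset V) (i j : V) : ℝ :=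
  almostPrincipalMinor S i j K / principalMinor S K

theorem principalMinor_pos (hS : S.PosDef) (K : Finset V) : 0 < principalMinor S K :=
  (hS.submatrix Subtype.val_injective).det_pos

/-- Subtracting the regression combination of the rows in K from row i clears that row on the
columns in K, so the matrix becomes block triangular. -/
theorem almostPrincipalMinor_eq {b : V → ℝ} (hb : ∀ k ∈ K, S i k = ∑ l ∈ K, b l * S l k)
    (j : V) : almostPrincipalMinor S i j K =
      (S i j - ∑ l ∈ K, b l * S l j) * principalMinor S K := by
  set N : Matrix (Unit ⊕ K) (Unit ⊕ K) ℝ :=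
    S.submatrix (Sum.elim (fun _ : Unit => i) (fun k : K => (k : V)))
      (Sum.elim (fun _ : Unit => j) (fun k : K => (k : V))) with hN
  set E : Matrix (Unit ⊕ K) (Unit ⊕ K) ℝ :=
    fromBlocks 1 (Matrix.of fun _ k => - b k) 0 1 with hE
  have h1 : E.det = 1 := by simp [hE]
  have h2 : E * N = fromBlocks (Matrix.of fun _ _ => S i j - ∑ l ∈ K, b l * S l j) 0
      (Matrix.of fun (k : K) _ => S k j) (S.submatrix (fun a : K => (a : V)) fun a : K => (a : V)) := by
    ext (_ | k) (_ | l)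
    · simp [hE, hN, Matrix.mul_apply, fromBlocks, ← Finset.sum_coe_sort K, sub_eq_add_neg]
    · have := hb l l.2
      rw [← Finset.sum_coe_sort K] at this
      simp [hE, hN, Matrix.mul_apply, fromBlocks, this]
    · simp [hE, hN, Matrix.mul_apply, fromBlocks, Matrix.one_apply]
    · simp [hE, hN, Matrix.mul_apply, fromBlocks, Matrix.one_apply]
  have h3 : (E * N).det = N.det := by rw [det_mul, h1, one_mul]
  rw [almostPrincipalMinor, ← hN, ← h3, h2, det_fromBlocks_zero₁₂]
  simp [principalMinor]

theorem condCov_eq (hS : S.PosDef) {b : V → ℝ}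
    (hb : ∀ k ∈ K, S i k = ∑ l ∈ K, b l * S l k) (j : V) :
    condCov S K i j = S i j - ∑ l ∈ K, b l * S l j := by
  rw [condCov, almostPrincipalMinor_eq hb, mul_div_assoc,
    div_self (principalMinor_pos hS K).ne', mul_one]

theorem exists_regression (hS : S.PosDef) (K : Finset V) (i : V) :
    ∃ b : V → ℝ, ∀ k ∈ K, S i k = ∑ l ∈ K, b l * S l k := by
  set M := S.submatrix (fun a : K => (a : V)) (fun a : K => (a : V)) with hM
  have hdet : IsUnit M.det := (principalMinor_pos hS K).ne'.isUnit
  set c : K → ℝ := (fun k : K => S i k) ᵥ* M⁻¹ with hc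
  have h : c ᵥ* M = fun k : K => S i k := by
    rw [hc, vecMul_vecMul, nonsing_inv_mul _ hdet, vecMul_one]
  refine ⟨fun v => if hv : v ∈ K then c ⟨v, hv⟩ else 0, fun k hk => ?_⟩
  have := congrFun h ⟨k, hk⟩
  simp only [vecMul, dotProduct, hM, submatrix_apply] at this
  rw [← this, ← Finset.sum_coe_sort K]
  exact Finset.sum_congr rfl fun x _ => by simp

theorem condCov_comm (hS : S.IsSymm) (i j : V) : condCov S K i j = condCov S K j i := by
  rw [condCov, condCov, almostPrincipalMinor, ← det_transpose, transpose_submatrix, hS.eq]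
  rfl

theorem _root_.Matrix.PosDef.isSymm_real (hS : S.PosDef) : S.IsSymm := by
  have := hS.isHermitian
  rwa [IsHermitian, conjTranspose_eq_transpose_of_trivial] at this

theorem condCov_of_mem_right (hS : S.PosDef) (hj : j ∈ K) : condCov S K i j = 0 := by
  obtain ⟨b, hb⟩ := exists_regression hS K i
  rw [condCov_eq hS hb, hb j hj, sub_self]

theorem condCov_congr {S' : Matrix V V ℝ}
    (h : ∀ u ∈ insert i (insert j K), ∀ v ∈ insert i (insert j K), S u v = S' u v) :
    condCov S K i j = condCov S' K i j := by
  have h1 : almostPrincipalMinor S i j K = almostPrincipalMinor S' i j K := by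
    unfold almostPrincipalMinor
    congr 1
    ext (_ | u) (_ | v) <;> simp only [submatrix_apply, Sum.elim_inl, Sum.elim_inr] <;>
      apply h <;> simp
  have h2 : principalMinor S K = principalMinor S' K := by
    unfold principalMinor
    congr 1
    ext u v
    simp only [submatrix_apply]
    apply h <;> simp
  rw [condCov, condCov, h1, h2]

theorem almostPrincipalMinor_self (hi : i ∉ K) :
    almostPrincipalMinor S i i K = principalMinor S (insert i K) := by
  let e : Unit ⊕ K ≃ (insert i K : Finset V) :=
    { toFun := Sum.elim (fun _ => ⟨i, by simp⟩) fun k => ⟨k, by simp⟩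
      invFun := fun v => if h : (v : V) ∈ K then Sum.inr ⟨v, h⟩ else Sum.inl ()
      left_inv := by rintro (_ | k) <;> simp [hi]
      right_inv := by
        rintro ⟨v, hv⟩
        by_cases h : v ∈ K
        · simp [h]
        · have : v = i := by simpa [h] using hv
          subst this
          simp [h] }
  rw [principalMinor, ← det_submatrix_equiv_self e, submatrix_submatrix, almostPrincipalMinor]
  congr 1
  ext (_ | u) (_ | v) <;> rfl

theorem condCov_self_pos (hS : S.PosDef) (hi : i ∉ K) : 0 < condCov S K i i := by
  rw [condCov, almostPrincipalMinor_self hi]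
  exact div_pos (principalMinor_pos hS _) (principalMinor_pos hS _)

theorem condCov_ne_zero_iff (hS : S.PosDef) :
    condCov S K i j ≠ 0 ↔ almostPrincipalMinor S i j K ≠ 0 := by
  simp [condCov, (principalMinor_pos hS K).ne']

theorem condCov_linear_right (hS : S.PosDef) {ι : Type*} (t : Finset ι) (c : ι → ℝ) (f : ι → V)
    (h : ∀ v ∈ insert i K, S v j = ∑ p ∈ t, c p * S v (f p)) :
    condCov S K i j = ∑ p ∈ t, c p * condCov S K i (f p) := by
  obtain ⟨b, hb⟩ := exists_regression hS K i
  simp only [condCov_eq hS hb, mul_sub, Finset.sum_sub_distrib]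
  rw [h i (by simp)]
  congr 1
  calc ∑ l ∈ K, b l * S l j = ∑ l ∈ K, ∑ p ∈ t, c p * (b l * S l (f p)) := by
        refine Finset.sum_congr rfl fun l hl => ?_
        rw [h l (by simp [hl]), Finset.mul_sum]
        exact Finset.sum_congr rfl fun p _ => by ring
    _ = _ := by
        rw [Finset.sum_comm]
        exact Finset.sum_congr rfl fun p _ => by rw [Finset.mul_sum]

/-- The regression on K ∪ {s} is the one on K followed by regression of the residual of i on the
residual of s, whose coefficient is γ. -/
theorem condCov_insert (hS : S.PosDef) {s : V} (hs : s ∉ K) :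
    condCov S (insert s K) i j =
      condCov S K i j - condCov S K i s * condCov S K s j / condCov S K s s := by
  obtain ⟨b, hb⟩ := exists_regression hS K i
  obtain ⟨d, hd⟩ := exists_regression hS K s
  have hpos := condCov_self_pos hS hs
  set γ := condCov S K i s / condCov S K s s with hγ
  have hsum : ∀ v, ∑ l ∈ insert s K, (if l = s then γ else b l - γ * d l) * S l v =
      γ * S s v + ((∑ l ∈ K, b l * S l v) - γ * ∑ l ∈ K, d l * S l v) := by
    intro v
    rw [Finset.sum_insert hs, if_pos rfl, Finset.mul_sum, ← Finset.sum_sub_distrib]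
    congr 1
    refine Finset.sum_congr rfl fun l hl => ?_
    rw [if_neg (by rintro rfl; exact hs hl)]
    ring
  have hres : ∀ v, S i v - ∑ l ∈ insert s K, (if l = s then γ else b l - γ * d l) * S l v =
      condCov S K i v - γ * condCov S K s v := by
    intro v
    rw [hsum, condCov_eq hS hb, condCov_eq hS hd]
    ring
  rw [condCov_eq hS (b := fun l => if l = s then γ else b l - γ * d l), hres, hγ]
  · ring
  · intro k hk
    rw [← sub_eq_zero, hres]
    rcases Finset.mem_insert.1 hk with rfl | hk
    · rw [hγ, div_mul_cancel₀ _ hpos.ne', sub_self]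
    · rw [condCov_of_mem_right hS hk, condCov_of_mem_right hS hk]
      ring

end CondCov

/-! ### The covariance matrix of the model -/

section Phi

variable {V : Type*} [Fintype V] [DecidableEq V] {G : Digraph V} {ω : V → ℝ} {Λ : Matrix V V ℝ}

/-- The number of ancestors of a vertex, which increases along the edges of a DAG. -/
noncomputable def depth (G : Digraph V) (v : V) : ℕ :=
  {u | Relation.TransGen G.Adj u v}.ncard

theorem depth_lt (hG : IsDAG G) {u v : V} (h : G.Adj u v) : depth G u < depth G v := by
  refine Set.ncard_lt_ncard ?_ (Set.toFinite _)
  refine ⟨fun w hw => hw.tail h, fun hsub => hG u (hsub (.single h))⟩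

/-- Edges strictly increase `depth`, so the matrix is block triangular for this grading, with
identity blocks on the diagonal. -/
theorem IsParam.det_one_sub (hG : IsDAG G) (h : IsParam G ω Λ) : (1 - Λ).det = 1 := by
  have hz : ∀ u v, depth G v ≤ depth G u → Λ u v = 0 := fun u v huv =>
    h.supp u v fun hadj => absurd (depth_lt hG hadj) (not_lt.2 huv)
  have hb : BlockTriangular (1 - Λ) (depth G) := by
    intro u v huv
    rw [Matrix.sub_apply, hz u v huv.le, one_apply_ne (by rintro rfl; exact lt_irrefl _ huv), sub_zero]
  rw [hb.det]
  refine Finset.prod_eq_one fun k _ => ?_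
  have : (1 - Λ).toSquareBlock (depth G) k = 1 := by
    ext ⟨u, hu⟩ ⟨v, hv⟩
    simp only [toSquareBlock_def, of_apply, Matrix.sub_apply, hz u v (by rw [hu, hv]), sub_zero, one_apply,
      Subtype.mk.injEq]
  rw [this, det_one]

theorem IsParam.inv_mul (hG : IsDAG G) (h : IsParam G ω Λ) : (1 - Λ)⁻¹ * (1 - Λ) = 1 :=
  nonsing_inv_mul _ (by simp [h.det_one_sub hG])

theorem IsParam.posDef (hG : IsDAG G) (h : IsParam G ω Λ) : (phi ω Λ).PosDef := by
  have h1 : (diagonal ω).PosDef := posDef_diagonal_iff.2 h.pos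
  have hu : IsUnit ((1 - Λ)⁻¹) := by
    rw [isUnit_nonsing_inv_iff, isUnit_iff_isUnit_det, h.det_one_sub hG]
    exact isUnit_one
  have := h1.conjTranspose_mul_mul_same (B := (1 - Λ)⁻¹) (mulVec_injective_of_isUnit hu)
  rwa [conjTranspose_eq_transpose_of_trivial] at this

theorem IsParam.inv_apply (hG : IsDAG G) (h : IsParam G ω Λ) (u v : V) :
    (1 - Λ)⁻¹ u v = (1 : Matrix V V ℝ) u v + ∑ p, (1 - Λ)⁻¹ u p * Λ p v := by
  have := congrFun (congrFun (h.inv_mul hG) u) v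
  rw [mul_sub, mul_one, Matrix.sub_apply, mul_apply] at this
  linarith

theorem IsParam.inv_apply_eq_zero (hG : IsDAG G) (h : IsParam G ω Λ) {u : V} (v : V)
    (hv : v ∉ deBar G u) : (1 - Λ)⁻¹ u v = 0 := by
  induction hn : depth G v using Nat.strong_induction_on generalizing v with
  | _ n ih =>
    simp only [deBar, Set.singleton_union, Set.mem_insert_iff, not_or] at hv
    rw [h.inv_apply hG, one_apply_ne (Ne.symm hv.1), zero_add]
    refine Finset.sum_eq_zero fun p _ => ?_
    by_cases hp : G.Adj p v
    · rw [ih _ (hn ▸ depth_lt hG hp) p _ rfl, zero_mul]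
      simp only [deBar, Set.singleton_union, Set.mem_insert_iff, not_or]
      refine ⟨?_, fun hpu => hv.2 (hpu.tail hp)⟩
      rintro rfl
      exact hv.2 (.single hp)
    · rw [h.supp _ _ hp, mul_zero]

theorem IsParam.inv_apply_self (hG : IsDAG G) (h : IsParam G ω Λ) (u : V) :
    (1 - Λ)⁻¹ u u = 1 := by
  rw [h.inv_apply hG, one_apply_eq, add_eq_left]
  refine Finset.sum_eq_zero fun p _ => ?_
  by_cases hp : G.Adj p u
  · rw [h.inv_apply_eq_zero hG p, zero_mul]
    rintro (rfl | hpu)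
    · exact hG _ (.single hp)
    · exact hG u (hpu.tail hp)
  · rw [h.supp _ _ hp, mul_zero]

theorem phi_apply (u v : V) :
    phi ω Λ u v = ∑ w, (1 - Λ)⁻¹ w u * ω w * (1 - Λ)⁻¹ w v := by
  simp only [phi, mul_apply (M := _ * _), mul_diagonal, transpose_apply]

theorem phi_comm (u v : V) : phi ω Λ u v = phi ω Λ v u := by
  simp only [phi_apply]
  exact Finset.sum_congr rfl fun w _ => by ring

/-- The structural equation of `v`. -/
theorem IsParam.phi_apply_right (hG : IsDAG G) (h : IsParam G ω Λ) (u v : V) :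
    phi ω Λ u v = (1 - Λ)⁻¹ v u * ω v + ∑ p, Λ p v * phi ω Λ u p := by
  have e : ∀ w, (1 - Λ)⁻¹ w u * ω w * (1 - Λ)⁻¹ w v =
      (1 - Λ)⁻¹ w u * ω w * (1 : Matrix V V ℝ) w v +
        ∑ p, Λ p v * ((1 - Λ)⁻¹ w u * ω w * (1 - Λ)⁻¹ w p) := by
    intro w
    conv_lhs => rw [h.inv_apply hG w v]
    rw [mul_add, Finset.mul_sum]
    congr 1
    exact Finset.sum_congr rfl fun p _ => by ring
  rw [phi_apply, Finset.sum_congr rfl fun w _ => e w, Finset.sum_add_distrib, Finset.sum_comm]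
  simp [phi_apply, Finset.mul_sum, one_apply]

theorem IsParam.phi_apply_nondescendant (hG : IsDAG G) (h : IsParam G ω Λ) {u v : V}
    (hu : u ∉ deBar G v) : phi ω Λ u v = ∑ p, Λ p v * phi ω Λ u p := by
  rw [h.phi_apply_right hG, h.inv_apply_eq_zero hG _ hu, zero_mul, zero_add]

theorem IsParam.phi_apply_self (hG : IsDAG G) (h : IsParam G ω Λ) (v : V) :
    phi ω Λ v v = ω v + ∑ p, Λ p v * phi ω Λ v p := by
  rw [h.phi_apply_right hG, h.inv_apply_self hG, one_mul]

/-- On an ancestral set, the covariance matrix depends only on the parameters at that set. -/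
theorem phi_congr (hG : IsDAG G) {ω' : V → ℝ} {Λ' : Matrix V V ℝ} (h : IsParam G ω Λ)
    (h' : IsParam G ω' Λ') {U : Set V} (hU : ∀ u v, G.Adj u v → v ∈ U → u ∈ U)
    (hω : ∀ v ∈ U, ω v = ω' v) (hΛ : ∀ v ∈ U, ∀ u, Λ u v = Λ' u v) {u v : V} (hu : u ∈ U)
    (hv : v ∈ U) : phi ω Λ u v = phi ω' Λ' u v := by
  have hB : ∀ v ∈ U, ∀ w, (1 - Λ)⁻¹ w v = (1 - Λ')⁻¹ w v := by
    intro v hv w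
    induction hn : depth G v using Nat.strong_induction_on generalizing v with
    | _ n ih =>
      rw [h.inv_apply hG, h'.inv_apply hG]
      congr 1
      refine Finset.sum_congr rfl fun p _ => ?_
      rw [← hΛ v hv]
      by_cases hp : G.Adj p v
      · rw [ih _ (hn ▸ depth_lt hG hp) p (hU _ _ hp hv) rfl]
      · rw [h.supp _ _ hp, mul_zero, mul_zero]
  have hde : ∀ {w u}, w ∈ de G u → w ∈ U → u ∈ U := by
    intro w u hw
    induction hw with
    | single h => exact hU _ _ h
    | tail _ h ih => exact fun hw => ih (hU _ _ h hw)
  rw [phi_apply, phi_apply]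
  refine Finset.sum_congr rfl fun w _ => ?_
  rw [← hB u hu, ← hB v hv]
  by_cases hw : w ∈ U
  · rw [hω w hw]
  · rw [h.inv_apply_eq_zero hG u, zero_mul, zero_mul, zero_mul, zero_mul]
    rintro (rfl | hwu)
    · exact hw hu
    · exact hw (hde hwu hu)

theorem IsParam.mono {G' : Digraph V} (h : IsParam G' ω Λ) (hGG : ∀ a b, G'.Adj a b → G.Adj a b) :
    IsParam G ω Λ :=
  ⟨h.pos, fun i j hij => h.supp i j fun h' => hij (hGG _ _ h')⟩

theorem isParam_of_pos (hω : ∀ i, 0 < ω i) : IsParam G ω 0 := ⟨hω, fun _ _ _ => rfl⟩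

/-- Two generic conditions can be satisfied at once. -/
theorem exists_condCov_ne_zero (hG : IsDAG G) {ω₁ ω₂ : V → ℝ} {Λ₁ Λ₂ : Matrix V V ℝ}
    (h₁ : IsParam G ω₁ Λ₁) (h₂ : IsParam G ω₂ Λ₂) {K₁ K₂ : Finset V} {i₁ j₁ i₂ j₂ : V}
    (hc₁ : condCov (phi ω₁ Λ₁) K₁ i₁ j₁ ≠ 0) (hc₂ : condCov (phi ω₂ Λ₂) K₂ i₂ j₂ ≠ 0) :
    ∃ ω Λ, IsParam G ω Λ ∧ condCov (phi ω Λ) K₁ i₁ j₁ ≠ 0 ∧ condCov (phi ω Λ) K₂ i₂ j₂ ≠ 0 := by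
  classical
  -- The two parameters are joined by a segment. For t in [0, 1] it stays in the model, the error
  -- variances being positive by convexity.
  let ωt : ℝ → V → ℝ := fun t v => ω₁ v + t * (ω₂ v - ω₁ v)
  let Λt : ℝ → Matrix V V ℝ := fun t => Λ₁ + t • (Λ₂ - Λ₁)
  have hpar : ∀ t ∈ Set.Icc (0 : ℝ) 1, IsParam G (ωt t) (Λt t) := by
    rintro t ⟨ht0, ht1⟩
    constructor
    · intro v
      have := h₁.pos v
      have := h₂.pos v
      show 0 < ω₁ v + t * (ω₂ v - ω₁ v)
      rcases ht1.lt_or_eq with ht | rfl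
      · nlinarith
      · linarith
    · intro u v huv
      simp [Λt, h₁.supp u v huv, h₂.supp u v huv]
  -- As det (1 − Λ) = 1, the inverse is the adjugate, and the covariances are polynomials in t. The
  -- two minors are polynomials that do not vanish at t = 0 and t = 1, respectively, so some t in
  -- [0, 1] avoids the roots of both.
  let P : Matrix V V (Polynomial ℝ) := Matrix.of fun u v =>
    Polynomial.C ((1 - Λ₁) u v) - Polynomial.X * Polynomial.C ((Λ₂ - Λ₁) u v)
  let Q : Matrix V V (Polynomial ℝ) := P.adjugateᵀ * diagonal (fun v =>
    Polynomial.C (ω₁ v) + Polynomial.X * Polynomial.C (ω₂ v - ω₁ v)) * P.adjugate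
  have hQ : ∀ t ∈ Set.Icc (0 : ℝ) 1, (Polynomial.evalRingHom t).mapMatrix Q =
      phi (ωt t) (Λt t) := by
    intro t ht
    have hP : (Polynomial.evalRingHom t).mapMatrix P = 1 - Λt t := by
      ext u v
      by_cases huv : u = v
      · simp [P, Λt, Matrix.sub_apply, one_apply, huv]
        ring
      · simp [P, Λt, Matrix.sub_apply, one_apply, huv]
        ring
    have hadj : (Polynomial.evalRingHom t).mapMatrix P.adjugate = (1 - Λt t)⁻¹ := by
      rw [RingHom.map_adjugate, hP, inv_def, (hpar t ht).det_one_sub hG]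
      simp
    have hT : (Polynomial.evalRingHom t).mapMatrix P.adjugateᵀ = ((1 - Λt t)⁻¹)ᵀ := by
      rw [← hadj]
      rfl
    rw [map_mul, map_mul, hT, hadj, phi]
    congr 2
    ext u v
    by_cases huv : u = v
    · subst huv
      simp [ωt]
    · simp [huv]
  let A : Finset V → V → V → Polynomial ℝ := fun K i j =>
    (Q.submatrix (Sum.elim (fun _ : Unit => i) (fun k : K => (k : V)))
      (Sum.elim (fun _ : Unit => j) (fun k : K => (k : V)))).det
  have hA : ∀ K i j, ∀ t ∈ Set.Icc (0 : ℝ) 1,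
      (A K i j).eval t = almostPrincipalMinor (phi (ωt t) (Λt t)) i j K := by
    intro K i j t ht
    rw [← hQ t ht, ← Polynomial.coe_evalRingHom, RingHom.map_det]
    rfl
  have hne : ∀ K i j, ∀ t ∈ Set.Icc (0 : ℝ) 1, condCov (phi (ωt t) (Λt t)) K i j ≠ 0 →
      A K i j ≠ 0 := by
    intro K i j t ht hc h0
    rw [condCov_ne_zero_iff ((hpar t ht).posDef hG), ← hA K i j t ht, h0] at hc
    simp at hc
  have e₁ : phi (ωt 0) (Λt 0) = phi ω₁ Λ₁ := by simp [ωt, Λt]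
  have e₂ : phi (ωt 1) (Λt 1) = phi ω₂ Λ₂ := by simp [ωt, Λt]
  have hA₁ : A K₁ i₁ j₁ ≠ 0 := hne _ _ _ 0 (by simp) (by rwa [e₁])
  have hA₂ : A K₂ i₂ j₂ ≠ 0 := hne _ _ _ 1 (by simp) (by rwa [e₂])
  obtain ⟨t, ht, htr⟩ := ((Set.Icc_infinite (zero_lt_one' ℝ)).sdiff
    ((A K₁ i₁ j₁ * A K₂ i₂ j₂).roots.toFinset.finite_toSet)).nonempty
  have hr : (A K₁ i₁ j₁).eval t ≠ 0 ∧ (A K₂ i₂ j₂).eval t ≠ 0 := by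
    simpa [Polynomial.mem_roots, mul_ne_zero hA₁ hA₂, hA₁, hA₂] using htr
  refine ⟨ωt t, Λt t, hpar t ht, ?_, ?_⟩
  · rw [condCov_ne_zero_iff ((hpar t ht).posDef hG), ← hA _ _ _ t ht]
    exact hr.1
  · rw [condCov_ne_zero_iff ((hpar t ht).posDef hG), ← hA _ _ _ t ht]
    exact hr.2

end Phi

/-! ### Generic non-vanishing of conditional covariances is connection by the Bayes ball -/

section Generic

variable {V : Type*} [Fintype V] [DecidableEq V] {G : Digraph V} {ω : V → ℝ} {Λ : Matrix V V ℝ}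
  {K : Finset V} {i j s : V}

/-- The conditional covariance of `i` and `j` given `K` does not vanish on the model. -/
def Dep (G : Digraph V) (K : Finset V) (i j : V) : Prop :=
  ∃ ω Λ, IsParam G ω Λ ∧ condCov (phi ω Λ) K i j ≠ 0

theorem dep_comm (hG : IsDAG G) : Dep G K i j ↔ Dep G K j i := by
  have : ∀ {i j}, Dep G K i j → Dep G K j i := fun ⟨ω, Λ, h, hc⟩ =>
    ⟨ω, Λ, h, by rwa [condCov_comm (h.posDef hG).isSymm_real]⟩
  exact ⟨this, this⟩

theorem Dep.notMem_right (hG : IsDAG G) (h : Dep G K i j) : j ∉ K := by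
  obtain ⟨ω, Λ, h, hc⟩ := h
  exact fun hj => hc (condCov_of_mem_right (h.posDef hG) hj)

theorem Dep.notMem_left (hG : IsDAG G) (h : Dep G K i j) : i ∉ K :=
  ((dep_comm hG).1 h).notMem_right hG

theorem dep_self (hG : IsDAG G) (hi : i ∉ K) : Dep G K i i :=
  have h : IsParam G (fun _ => 1) 0 := isParam_of_pos fun _ => one_pos
  ⟨_, _, h, (condCov_self_pos (h.posDef hG) hi).ne'⟩

theorem isolate_adj {a b : V} (h : (isolate G s).Adj a b) : G.Adj a b := h.1

theorem IsParam.of_isolate (h : IsParam (isolate G s) ω Λ) : IsParam G ω Λ :=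
  h.mono fun _ _ => isolate_adj

theorem IsParam.isolate_col (h : IsParam (isolate G s) ω Λ) (u : V) : Λ u s = 0 :=
  h.supp u s fun hu => hu.2.2 rfl

theorem IsParam.updateCol_zero (hs : ∀ w, ¬ G.Adj s w) (h : IsParam G ω Λ) :
    IsParam (isolate G s) ω (Λ.updateCol s 0) := by
  refine ⟨h.pos, fun u v huv => ?_⟩
  by_cases hv : v = s
  · subst hv; simp
  · rw [updateCol_ne hv]
    by_cases hu : u = s
    · subst hu; exact h.supp _ _ (hs _)
    · exact h.supp _ _ fun h' => huv ⟨h', hu, hv⟩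

theorem IsParam.updateCol_single {p : V} (hp : G.Adj p s) (h : IsParam G ω Λ) :
    IsParam G ω (Λ.updateCol s (Pi.single p 1)) := by
  refine ⟨h.pos, fun u v huv => ?_⟩
  by_cases hv : v = s
  · subst hv
    rw [updateCol_self, Pi.single_eq_of_ne]
    rintro rfl
    exact huv hp
  · rw [updateCol_ne hv]
    exact h.supp _ _ huv

/-- The complement of a sink is ancestral, so the covariances there do not depend on the
coefficients into the sink. -/
theorem condCov_updateCol (hG : IsDAG G) (hs : ∀ w, ¬ G.Adj s w) {c : V → ℝ}
    (h : IsParam G ω Λ) (h' : IsParam G ω (Λ.updateCol s c)) (hsK : s ∉ K) (hi : i ≠ s)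
    (hj : j ≠ s) : condCov (phi ω (Λ.updateCol s c)) K i j = condCov (phi ω Λ) K i j := by
  have hne : ∀ u ∈ insert i (insert j K), u ≠ s := by
    intro u hu
    simp only [Finset.mem_insert] at hu
    rcases hu with rfl | rfl | hu
    · exact hi
    · exact hj
    · rintro rfl; exact hsK hu
  refine condCov_congr fun u hu v hv => ?_
  refine phi_congr hG h' h (U := {s}ᶜ) ?_ (fun _ _ => rfl) ?_ (hne u hu) (hne v hv)
  · rintro a b hab - rfl
    exact hs _ hab
  · intro v hv u
    exact updateCol_ne hv

theorem dep_isolate_iff (hG : IsDAG G) (hs : ∀ w, ¬ G.Adj s w) (hsK : s ∉ K) (hi : i ≠ s)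
    (hj : j ≠ s) : Dep G K i j ↔ Dep (isolate G s) K i j := by
  constructor
  · rintro ⟨ω, Λ, h, hc⟩
    have h' := h.updateCol_zero hs
    exact ⟨ω, _, h', by rwa [condCov_updateCol hG hs h h'.of_isolate hsK hi hj]⟩
  · rintro ⟨ω, Λ, h, hc⟩
    exact ⟨ω, Λ, h.of_isolate, hc⟩

theorem deBar_eq_singleton (hs : ∀ w, ¬ G.Adj s w) : deBar G s = {s} := by
  refine Set.union_eq_self_of_subset_right fun v hv => ?_
  obtain ⟨w, hw, -⟩ := Relation.TransGen.head'_iff.1 hv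
  exact absurd hw (hs w)

theorem IsParam.condCov_sink (hG : IsDAG G) (hs : ∀ w, ¬ G.Adj s w) (h : IsParam G ω Λ)
    (hsK : s ∉ K) (hi : i ≠ s) :
    condCov (phi ω Λ) K i s = ∑ p, Λ p s * condCov (phi ω Λ) K i p := by
  refine condCov_linear_right (h.posDef hG) Finset.univ (fun p => Λ p s) id fun v hv => ?_
  refine h.phi_apply_nondescendant hG ?_
  rw [deBar_eq_singleton hs]
  rintro rfl
  rcases Finset.mem_insert.1 hv with h | h
  · exact hi h.symm
  · exact hsK h

/-- By the structural equation, the conditional covariance with s is a combination of those with its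
parents. The coefficients are free, so a unit vector singles out one parent. -/
theorem dep_sink_right_iff (hG : IsDAG G) (hs : ∀ w, ¬ G.Adj s w) (hsK : s ∉ K) (hi : i ≠ s) :
    Dep G K i s ↔ ∃ p, G.Adj p s ∧ Dep (isolate G s) K i p := by
  constructor
  · rintro ⟨ω, Λ, h, hc⟩
    rw [h.condCov_sink hG hs hsK hi] at hc
    obtain ⟨p, -, hp⟩ := Finset.exists_ne_zero_of_sum_ne_zero hc
    have hps : G.Adj p s := by
      by_contra hps
      exact hp (by rw [h.supp _ _ hps, zero_mul])
    refine ⟨p, hps, (dep_isolate_iff hG hs hsK hi ?_).1 ⟨ω, Λ, h, right_ne_zero_of_mul hp⟩⟩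
    rintro rfl
    exact hs _ hps
  · rintro ⟨p, hps, ω, Λ, h, hc⟩
    have hp : p ≠ s := by rintro rfl; exact hs _ hps
    have h' := h.of_isolate.updateCol_single hps
    refine ⟨ω, _, h', ?_⟩
    rw [h'.condCov_sink hG hs hsK hi, Finset.sum_eq_single p]
    · rw [updateCol_self, Pi.single_eq_same, one_mul,
        condCov_updateCol hG hs h.of_isolate h' hsK hi hp]
      exact hc
    · intro q _ hq
      rw [updateCol_self, Pi.single_eq_of_ne hq, zero_mul]
    · simp

theorem dep_sink_left_iff (hG : IsDAG G) (hs : ∀ w, ¬ G.Adj s w) (hsK : s ∉ K) (hj : j ≠ s) :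
    Dep G K s j ↔ ∃ p, G.Adj p s ∧ Dep (isolate G s) K p j := by
  rw [dep_comm hG, dep_sink_right_iff hG hs hsK hj]
  exact exists_congr fun p => and_congr_right fun _ =>
    dep_comm (hG.mono fun _ _ => isolate_adj)

/-- In `condCov_insert`, parameters without edges at s kill the correction term, so a non-vanishing
first term survives. If the first term vanishes identically, what remains is a product whose factors
are made non-zero simultaneously by `exists_condCov_ne_zero`. -/
theorem dep_insert_sink_iff (hG : IsDAG G) (hs : ∀ w, ¬ G.Adj s w) (hsK : s ∉ K) (hi : i ≠ s)
    (hj : j ≠ s) : Dep G (insert s K) i j ↔ Dep (isolate G s) K i j ∨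
      ((∃ a, G.Adj a s ∧ Dep (isolate G s) K i a) ∧
        ∃ b, G.Adj b s ∧ Dep (isolate G s) K b j) := by
  rw [← dep_sink_right_iff hG hs hsK hi, ← dep_sink_left_iff hG hs hsK hj]
  constructor
  · rintro ⟨ω, Λ, h, hc⟩
    rw [condCov_insert (h.posDef hG) hsK] at hc
    by_cases h0 : condCov (phi ω Λ) K i j = 0
    · right
      rw [h0, zero_sub, neg_ne_zero, div_ne_zero_iff, mul_ne_zero_iff] at hc
      exact ⟨⟨ω, Λ, h, hc.1.1⟩, ⟨ω, Λ, h, hc.1.2⟩⟩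
    · exact Or.inl ((dep_isolate_iff hG hs hsK hi hj).1 ⟨ω, Λ, h, h0⟩)
  · intro hor
    by_cases hdep : Dep (isolate G s) K i j
    · obtain ⟨ω, Λ, h, hc⟩ := hdep
      refine ⟨ω, Λ, h.of_isolate, ?_⟩
      rw [condCov_insert (h.of_isolate.posDef hG) hsK, h.of_isolate.condCov_sink hG hs hsK hi]
      simpa [h.isolate_col] using hc
    · obtain ⟨⟨ω₁, Λ₁, h₁, hc₁⟩, ω₂, Λ₂, h₂, hc₂⟩ := hor.resolve_left hdep
      obtain ⟨ω, Λ, h, hc, hc'⟩ := exists_condCov_ne_zero hG h₁ h₂ hc₁ hc₂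
      refine ⟨ω, Λ, h, ?_⟩
      have h0 : condCov (phi ω Λ) K i j = 0 := by
        by_contra h0
        exact hdep ((dep_isolate_iff hG hs hsK hi hj).1 ⟨ω, Λ, h, h0⟩)
      rw [condCov_insert (h.posDef hG) hsK, h0, zero_sub, neg_ne_zero]
      exact div_ne_zero (mul_ne_zero hc hc') (condCov_self_pos (h.posDef hG) hsK).ne'

theorem dep_iff_conn_of_forall_not_adj (hG : IsDAG G) (h0 : ∀ a b, ¬ G.Adj a b) :
    Dep G K i j ↔ Conn G K i j := by
  by_cases hi : i ∈ K
  · exact ⟨fun h => absurd hi (h.notMem_left hG), fun h => absurd hi h.1⟩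
  by_cases hij : i = j
  · subst hij
    exact ⟨fun _ => ⟨hi, hi, _, .start⟩, fun _ => dep_self hG hi⟩
  refine iff_of_false ?_ ?_
  · rintro ⟨ω, Λ, h, hc⟩
    have hΛ : Λ = 0 := by
      ext a b
      exact h.supp a b (h0 a b)
    have hphi : ∀ v, i ≠ v → phi ω Λ i v = 0 := fun v hv => by
      simp [phi, hΛ, one_apply_ne hv]
    refine hc ?_
    rw [condCov_eq (h.posDef hG) (b := 0)]
    · simp [hphi j hij]
    · intro k hk
      simp [hphi k (by rintro rfl; exact hi hk)]
  · rintro ⟨-, -, d, hd⟩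
    cases hd with
    | start => exact hij rfl
    | child _ _ h => exact h0 _ _ h
    | parent _ _ h => exact h0 _ _ h

theorem exists_sink (hG : IsDAG G) {U : Finset V} (hU : U.Nonempty)
    (hGU : ∀ a b, G.Adj a b → b ∈ U) : ∃ s ∈ U, ∀ w, ¬ G.Adj s w := by
  obtain ⟨s, hs, hmax⟩ := U.exists_max_image (depth G) hU
  exact ⟨s, hs, fun w hw => absurd (depth_lt hG hw) (not_lt.2 (hmax w (hGU _ _ hw)))⟩

/-- The conditional covariance vanishes on the model if and only if the Bayes ball does not
connect the two vertices. -/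
theorem dep_iff_conn (hG : IsDAG G) : Dep G K i j ↔ Conn G K i j := by
  -- Isolating a sink keeps the vertex type, so the induction runs over the size of a set U that
  -- contains the heads of all edges.
  suffices H : ∀ (n : ℕ) (U : Finset V) (G : Digraph V), U.card = n → IsDAG G →
      (∀ a b, G.Adj a b → b ∈ U) → ∀ (K : Finset V) (i j : V), Dep G K i j ↔ Conn G K i j from
    H _ Finset.univ G rfl hG (fun _ _ _ => Finset.mem_univ _) K i j
  intro n
  induction n with
  | zero =>
    intro U G hU hG hGU K i j
    refine dep_iff_conn_of_forall_not_adj hG fun a b hab => ?_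
    have := hGU a b hab
    rw [Finset.card_eq_zero.1 hU] at this
    simp at this
  | succ n ih =>
    intro U G hU hG hGU K i j
    obtain ⟨s, hsU, hs⟩ := exists_sink hG (Finset.card_pos.1 (hU ▸ n.succ_pos)) hGU
    have IH := ih (U.erase s) (isolate G s) (by rw [Finset.card_erase_of_mem hsU, hU]; rfl)
      (hG.mono fun _ _ => isolate_adj)
      (fun a b hab => Finset.mem_erase.2 ⟨hab.2.2, hGU _ _ hab.1⟩)
    by_cases hi : i ∈ K
    · exact ⟨fun h => absurd hi (h.notMem_left hG), fun h => absurd hi h.1⟩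
    by_cases hj : j ∈ K
    · exact ⟨fun h => absurd hj (h.notMem_right hG), fun h => absurd hj h.2.1⟩
    by_cases hij : i = j
    · subst hij
      exact ⟨fun _ => ⟨hi, hi, _, .start⟩, fun _ => dep_self hG hi⟩
    by_cases hsK : s ∈ K
    · have his : i ≠ s := by rintro rfl; exact hi hsK
      have hjs : j ≠ s := by rintro rfl; exact hj hsK
      rw [← Finset.insert_erase hsK, dep_insert_sink_iff hG hs (by simp) his hjs,
        Finset.coe_insert, conn_insert_sink_iff hs (by simp) his hjs]
      simp only [IH]
    · by_cases hjs : j = s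
      · subst hjs
        rw [dep_sink_right_iff hG hs hsK hij, conn_sink_right_iff hs hsK hij]
        simp only [IH]
      · by_cases his : i = s
        · subst his
          rw [dep_sink_left_iff hG hs hsK hjs, conn_sink_left_iff hs hsK hjs]
          simp only [IH]
        · rw [dep_isolate_iff hG hs hsK his hjs, conn_isolate_iff hs hsK his hjs, IH]

/-- A pair of vertices is d-separated if and only if the conditional covariance vanishes. -/
theorem dSeparates_iff_not_dep (hG : IsDAG G) (hi : i ∉ K) :
    DSeparates G K {i} {j} ↔ ¬ Dep G K i j := by
  rw [dSeparates_iff_not_conn hG (by simpa using hi), dep_comm hG, dep_iff_conn hG]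

end Generic

/-! ### Identification of the parameters, and the special parameters that show necessity -/

section Identification

variable {V : Type*} [Fintype V] [DecidableEq V] {G : Digraph V} {ω : V → ℝ} {Λ : Matrix V V ℝ}
  {S : Matrix V V ℝ} {A : Finset V} {i j : V}

theorem self_mem_deBar : i ∈ deBar G i := by simp [deBar]

theorem mem_deBar_of_adj {u v : V} (hu : u ∈ deBar G i) (h : G.Adj u v) : v ∈ de G i := by
  rcases hu with rfl | hu
  · exact .single h
  · exact hu.tail h

theorem notMem_deBar_of_adj (hG : IsDAG G) (h : G.Adj i j) : i ∉ deBar G j :=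
  fun hi => self_notMem_de hG j (mem_deBar_of_adj hi h)

theorem omegaFun_of_notMem (hi : i ∉ A) : omegaFun i A S = condCov S A i i := by
  rw [omegaFun, condCov, almostPrincipalMinor_self hi]

theorem omegaFun_of_mem (hS : S.PosDef) (hi : i ∈ A) : omegaFun i A S = 1 := by
  rw [omegaFun, Finset.insert_eq_of_mem hi, div_self (principalMinor_pos hS A).ne']

theorem lambdaFun_of_notMem (hi : i ∉ A) : lambdaFun i j A S = condCov S A i j := by
  rw [lambdaFun, Finset.erase_eq_of_notMem hi, condCov]

theorem lambdaFun_of_mem (hS : S.PosDef) (hi : i ∈ A) :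
    lambdaFun i j A S = condCov S (A.erase i) i j / condCov S (A.erase i) i i := by
  rw [lambdaFun, condCov, condCov, almostPrincipalMinor_self (by simp), Finset.insert_erase hi,
    div_div_div_cancel_right₀ (principalMinor_pos hS _).ne']

/-- `lambdaFun i j A` is the coefficient of `i` in the regression of `j` on `A`. -/
theorem lambdaFun_eq_of_regression (hS : S.PosDef) (hi : i ∈ A) {b : V → ℝ}
    (hb : ∀ k ∈ A, S k j = ∑ l ∈ A, b l * S k l) : lambdaFun i j A S = b i := by
  rw [lambdaFun_of_mem hS hi,
    condCov_linear_right (j := j) hS A b id fun v hv => hb v (by rwa [Finset.insert_erase hi] at hv),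
    Finset.sum_eq_single i]
  · exact mul_div_cancel_right₀ _ (condCov_self_pos hS (by simp)).ne'
  · intro l hl hli
    rw [id, condCov_of_mem_right hS (Finset.mem_erase.2 ⟨hli, hl⟩), mul_zero]
  · exact fun h => absurd hi h

/-- Parameters for which the variable of a descendant `v` of `j` is the sum of the errors along
a directed path from `j` to `v`, plus the contribution `f` of the parents of `j`; the other
variables are their own errors. -/
theorem exists_pathParam (hG : IsDAG G) {f : V → ℝ} (hf : ∀ u, ¬ G.Adj u j → f u = 0) {v : V}
    (hv : v ∈ deBar G j) :
    ∃ (Λ B : Matrix V V ℝ) (P : Finset V), IsParam G (fun _ => 1) Λ ∧ B * (1 - Λ) = 1 ∧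
      j ∈ P ∧ v ∈ P ∧ (∀ u ∈ P, u ∈ deBar G j) ∧ (∀ u ∈ P, u ≠ v → depth G u < depth G v) ∧
      (∀ k ∉ P, ∀ u, B u k = (1 : Matrix V V ℝ) u k ∧ Λ u k = 0) ∧
      (∀ u, B u j = (1 : Matrix V V ℝ) u j + f u ∧ Λ u j = f u) ∧
      (∀ u, B u v = f u + if u ∈ P then 1 else 0) := by
  have hfj : f j = 0 := hf j fun h => hG j (.single h)
  have hv' : Relation.ReflTransGen G.Adj j v := by
    rcases hv with rfl | hv
    · exact .refl
    · exact hv.to_reflTransGen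
  induction hv' with
  | refl =>
    have hcol : ∀ k ≠ j, ∀ u, (0 : Matrix V V ℝ).updateCol j f u k = 0 := fun k hk u => by
      rw [updateCol_ne hk]; rfl
    refine ⟨(0 : Matrix V V ℝ).updateCol j f, 1 + (0 : Matrix V V ℝ).updateCol j f, {j},
      ⟨fun _ => one_pos, fun u k huk => ?_⟩, ?_, by simp, by simp, ?_, by simp, ?_, ?_, ?_⟩
    · by_cases hk : k = j
      · subst hk; rw [updateCol_self, hf u huk]
      · exact hcol k hk u
    · have : (0 : Matrix V V ℝ).updateCol j f * (0 : Matrix V V ℝ).updateCol j f = 0 := by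
        ext a b
        rw [mul_apply]
        refine Finset.sum_eq_zero fun c _ => ?_
        by_cases hc : c = j
        · subst hc
          by_cases hb : b = c
          · subst hb; rw [updateCol_self, updateCol_self, hfj, mul_zero]
          · rw [hcol b hb, mul_zero]
        · rw [hcol c hc, zero_mul]
      rw [add_mul, mul_sub, mul_sub, this]
      simp
    · intro u hu
      rw [Finset.mem_singleton.1 hu]
      exact self_mem_deBar
    · intro k hk u
      rw [Finset.mem_singleton] at hk
      rw [Matrix.add_apply, hcol k hk, add_zero]
      exact ⟨rfl, rfl⟩
    · intro u
      rw [Matrix.add_apply, updateCol_self]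
      exact ⟨rfl, rfl⟩
    · intro u
      rw [Matrix.add_apply, updateCol_self, one_apply, add_comm]
      simp
  | @tail v w hjv hvw ih =>
    have hvd : v ∈ deBar G j := by
      rcases Relation.reflTransGen_iff_eq_or_transGen.1 hjv with rfl | h
      · exact self_mem_deBar
      · exact Or.inr h
    obtain ⟨Λ, B, P, hΛ, hB, hjP, hvP, hPd, hPv, hout, hj, hBv⟩ := ih hvd
    have hdw := depth_lt hG hvw
    have hlt : ∀ u ∈ P, depth G u < depth G w := fun u hu => by
      by_cases h : u = v
      · rw [h]; exact hdw
      · exact (hPv u hu h).trans hdw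
    have hwP : w ∉ P := fun h => lt_irrefl _ (hlt w h)
    have hjw : j ≠ w := fun h => hwP (h ▸ hjP)
    -- No coefficient leaves the new end w of the path, so changing column w affects only column w
    -- of the product B (1 − Λ).
    have hrow : ∀ c, Λ w c = 0 := fun c => by
      by_cases hc : c ∈ P
      · exact hΛ.supp _ _ fun h => lt_asymm (hlt c hc) (depth_lt hG h)
      · exact (hout c hc w).2
    refine ⟨Λ.updateCol w (Pi.single v 1), B.updateCol w fun u => f u + if u ∈ insert w P then 1 else 0,
      insert w P, hΛ.updateCol_single hvw, ?_, by simp [hjP], by simp, ?_, ?_, ?_, ?_, ?_⟩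
    · have hB' : ∀ a c, B a c - ∑ p, B a p * Λ p c = (1 : Matrix V V ℝ) a c := fun a c => by
        have := congrFun (congrFun hB a) c
        rwa [mul_sub, mul_one, Matrix.sub_apply, mul_apply] at this
      ext a c
      rw [mul_sub, mul_one, Matrix.sub_apply, mul_apply]
      by_cases hc : c = w
      · subst hc
        rw [Finset.sum_eq_single v]
        · rw [updateCol_self, updateCol_self, Pi.single_eq_same, mul_one,
            updateCol_ne (hG.ne hvw), hBv, one_apply]
          by_cases hac : a = c
          · subst hac; simp [hwP]
          · simp [hac]
        · intro p _ hp
          rw [updateCol_self, Pi.single_eq_of_ne hp, mul_zero]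
        · simp
      · rw [updateCol_ne hc, ← hB' a c]
        congr 1
        refine Finset.sum_congr rfl fun p _ => ?_
        rw [updateCol_ne hc]
        by_cases hp : p = w
        · rw [hp, hrow, mul_zero, mul_zero]
        · rw [updateCol_ne hp]
    · intro u hu
      rcases Finset.mem_insert.1 hu with rfl | hu
      · exact Or.inr (mem_deBar_of_adj hvd hvw)
      · exact hPd u hu
    · intro u hu huw
      exact hlt u ((Finset.mem_insert.1 hu).resolve_left huw)
    · intro k hk u
      rw [Finset.mem_insert, not_or] at hk
      rw [updateCol_ne hk.1, updateCol_ne hk.1]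
      exact hout k hk.2 u
    · intro u
      rw [updateCol_ne hjw, updateCol_ne hjw]
      exact hj u
    · intro u
      rw [updateCol_self]

/-- The covariances of the parameters given by `exists_pathParam`. -/
theorem exists_pathCov (hG : IsDAG G) {f : V → ℝ} (hf : ∀ u, ¬ G.Adj u j → f u = 0) {v : V}
    (hv : v ∈ deBar G j) :
    ∃ (Λ : Matrix V V ℝ) (P : Finset V), IsParam G (fun _ => 1) Λ ∧ (∀ u, Λ u j = f u) ∧
      j ∈ P ∧ v ∈ P ∧ (∀ u ∈ P, u ∈ deBar G j) ∧ (∀ u ∈ P, u ≠ v → depth G u < depth G v) ∧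
      (∀ k ∉ P, ∀ l ∉ P, phi (fun _ => 1) Λ k l = (1 : Matrix V V ℝ) k l) ∧
      (∀ k ∉ P, phi (fun _ => 1) Λ k j = f k ∧ phi (fun _ => 1) Λ k v = f k) ∧
      phi (fun _ => 1) Λ j j = 1 + ∑ u, f u ^ 2 ∧
      phi (fun _ => 1) Λ v j = 1 + ∑ u, f u ^ 2 ∧
      phi (fun _ => 1) Λ v v = P.card + ∑ u, f u ^ 2 := by
  obtain ⟨Λ, B, P, hΛ, hB, hjP, hvP, hPd, hPv, hout, hj, hBv⟩ := exists_pathParam hG hf hv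
  have hfP : ∀ u ∈ P, f u = 0 := fun u hu => hf u fun h => notMem_deBar_of_adj hG h (hPd u hu)
  have hphi : ∀ a b, phi (fun _ => 1) Λ a b = ∑ w, B w a * B w b := fun a b => by
    simp [phi_apply, inv_eq_left_inv hB]
  have hk : ∀ k ∉ P, ∀ b, phi (fun _ => 1) Λ k b = B k b := fun k hk b => by
    rw [hphi, Finset.sum_eq_single k]
    · rw [(hout k hk k).1, one_apply_eq, one_mul]
    · intro w _ hw
      rw [(hout k hk w).1, one_apply_ne hw, zero_mul]
    · simp
  refine ⟨Λ, P, hΛ, fun u => (hj u).2, hjP, hvP, hPd, hPv, fun k hkP l hl => ?_,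
    fun k hkP => ⟨?_, ?_⟩, ?_, ?_, ?_⟩
  · rw [hk k hkP, (hout l hl k).1]
  · rw [hk k hkP, (hj k).1, one_apply_ne (by rintro rfl; exact hkP hjP), zero_add]
  · rw [hk k hkP, hBv, if_neg hkP, add_zero]
  · have e : ∀ w, B w j * B w j = (if w = j then 1 else 0) + f w ^ 2 := fun w => by
      rw [(hj w).1, one_apply]
      by_cases h : w = j
      · rw [h, hfP j hjP]; simp
      · simp [h]; ring
    rw [hphi, Finset.sum_congr rfl fun w _ => e w, Finset.sum_add_distrib]
    simp
  · have e : ∀ w, B w v * B w j = (if w = j then 1 else 0) + f w ^ 2 := fun w => by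
      rw [(hj w).1, hBv, one_apply]
      by_cases h : w = j
      · rw [h, hfP j hjP]; simp [hjP]
      · by_cases hw : w ∈ P
        · simp [h, hfP w hw]
        · simp [h, hw]; ring
    rw [hphi, Finset.sum_congr rfl fun w _ => e w, Finset.sum_add_distrib]
    simp
  · have e : ∀ w, B w v * B w v = (if w ∈ P then 1 else 0) + f w ^ 2 := fun w => by
      rw [hBv]
      by_cases hw : w ∈ P
      · simp [hw, hfP w hw]
      · simp [hw]; ring
    rw [hphi, Finset.sum_congr rfl fun w _ => e w, Finset.sum_add_distrib]
    simp

/-- A descendant of least depth. -/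
theorem exists_min_depth (h : ∃ d ∈ A, d ∈ deBar G j) :
    ∃ d ∈ A, d ∈ deBar G j ∧ ∀ k ∈ A, k ∈ deBar G j → depth G d ≤ depth G k := by
  classical
  obtain ⟨d, hd, hdj⟩ := h
  obtain ⟨e, he, hmin⟩ := (A.filter (· ∈ deBar G j)).exists_min_image (depth G)
    ⟨d, by simp [hd, hdj]⟩
  rw [Finset.mem_filter] at he
  exact ⟨e, he.1, he.2, fun k hk hkj => hmin k (by simp [hk, hkj])⟩

theorem forall_omegaFun_iff (hG : IsDAG G) (i : V) (A : Finset V) :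
    (∀ (ω : V → ℝ) (Λ : Matrix V V ℝ), IsParam G ω Λ → ω i = omegaFun i A (phi ω Λ)) ↔
      pa G i ⊆ A ∧ (A : Set V) ⊆ Set.univ \ deBar G i := by
  constructor
  · intro H
    have hiA : i ∉ A := by
      intro hi
      -- For i ∈ A, `omegaFun` is 1, so any error variance other than 1 is a contradiction.
      have h : IsParam G (fun _ => 2) 0 := isParam_of_pos fun _ => two_pos
      have := H _ _ h
      rw [omegaFun_of_mem (h.posDef hG) hi] at this
      norm_num at this
    have H' : ∀ (ω : V → ℝ) (Λ : Matrix V V ℝ), IsParam G ω Λ →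
        ω i = condCov (phi ω Λ) A i i := fun ω Λ h => by
      rw [H ω Λ h, omegaFun_of_notMem hiA]
    have hde : ∀ d ∈ A, d ∉ deBar G i := by
      by_contra! hcon
      obtain ⟨d, hd, hdi, hmin⟩ := exists_min_depth hcon
      obtain ⟨Λ, P, h, -, hiP, hdP, hPi, hPd, -, hk, hii, hdi', hdd⟩ :=
        exists_pathCov hG (f := 0) (fun _ _ => rfl) hdi
      have hAP : ∀ k ∈ A, k ≠ d → k ∉ P := fun k hkA hkd hkP =>
        absurd (hPd k hkP hkd) (not_lt.2 (hmin k hkA (hPi k hkP)))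
      have hcard : (0 : ℝ) < P.card := by exact_mod_cast Finset.card_pos.2 ⟨i, hiP⟩
      have := H' _ _ h
      -- As d has least depth, the path meets A only in d, and the other members of A are
      -- uncorrelated with i and d. The variable of d is a sum of |P| unit errors, one of them that
      -- of i. The coefficient of d is thus 1/|P|, and the residual variance 1 − 1/|P| differs from
      -- ω_i = 1.
      have hsum : ∀ k, ∑ l ∈ A, (Pi.single d (1 / P.card : ℝ) : V → ℝ) l * phi (fun _ => 1) Λ l k =
          1 / P.card * phi (fun _ => 1) Λ d k := fun k => by
        rw [Finset.sum_eq_single d]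
        · rw [Pi.single_eq_same]
        · intro l _ hl
          rw [Pi.single_eq_of_ne hl, zero_mul]
        · exact fun h => absurd hd h
      rw [condCov_eq (h.posDef hG) (b := Pi.single d (1 / P.card : ℝ)), hsum, hii, hdi'] at this
      · have hinv := inv_pos.2 hcard
        simp at this
        linarith
      · intro k hkA
        rw [hsum]
        by_cases hkd : k = d
        · subst hkd
          rw [phi_comm, hdi', hdd]
          simp only [Pi.zero_apply, ne_eq, OfNat.ofNat_ne_zero, not_false_eq_true, zero_pow,
            Finset.sum_const_zero, add_zero]
          exact (one_div_mul_cancel hcard.ne').symm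
        · have := hk k (hAP k hkA hkd)
          rw [phi_comm, this.1, phi_comm, this.2, Pi.zero_apply, mul_zero]
    refine ⟨fun k hki => ?_, fun d hd => ⟨trivial, hde d hd⟩⟩
    by_contra hkA
    obtain ⟨Λ, P, h, -, hiP, -, hPi, -, -, hk, hii, -⟩ :=
      exists_pathCov hG (j := i) (f := Pi.single k 1) (fun u hu => Pi.single_eq_of_ne (by
        rintro rfl; exact hu hki) _) self_mem_deBar
    have := H' _ _ h
    -- Here i is the sum of its own error and that of k, and it is uncorrelated with A, so its
    -- residual variance is 2 instead of 1.
    rw [condCov_eq (h.posDef hG) (b := 0), hii] at this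
    · simp [Pi.single_apply] at this
    · intro l hl
      rw [phi_comm, (hk l fun hlP => hde l hl (hPi l hlP)).1, Pi.single_eq_of_ne]
      · simp
      · rintro rfl
        exact hkA hl
  · rintro ⟨hpa, hA⟩ ω Λ h
    have hA' : ∀ k ∈ A, k ∉ deBar G i := fun k hk => (hA hk).2
    have hiA : i ∉ A := fun hi => hA' i hi self_mem_deBar
    have hsum : ∀ k, ∑ l ∈ A, Λ l i * phi ω Λ l k = ∑ p, Λ p i * phi ω Λ k p := fun k => by
      rw [← Finset.sum_subset (Finset.subset_univ A)]
      · exact Finset.sum_congr rfl fun l _ => by rw [phi_comm]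
      · intro p _ hp
        rw [h.supp p i fun hpi => hp (hpa hpi), zero_mul]
    rw [omegaFun_of_notMem hiA, condCov_eq (h.posDef hG) (b := fun l => Λ l i), hsum,
      h.phi_apply_self hG, add_sub_cancel_right]
    intro k hk
    rw [hsum, phi_comm, h.phi_apply_nondescendant hG (hA' k hk)]

/-- Only the numerator matters for vanishing, and it is that of the conditional covariance given
A∖i, whether or not i ∈ A. -/
theorem forall_lambdaFun_eq_zero_iff (hG : IsDAG G) (hij : ¬ G.Adj i j) (A : Finset V) :
    (∀ (ω : V → ℝ) (Λ : Matrix V V ℝ), IsParam G ω Λ →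
        Λ i j = 0 ∧ 0 = lambdaFun i j A (phi ω Λ)) ↔
      DSeparates G ((A : Set V) \ {i}) {i} {j} := by
  rw [← Finset.coe_erase, dSeparates_iff_not_dep hG (by simp), Dep]
  push Not
  refine forall_congr' fun ω => forall_congr' fun Λ => forall_congr' fun h => ?_
  rw [lambdaFun, eq_comm (a := (0 : ℝ)), div_eq_zero_iff, condCov, div_eq_zero_iff]
  simp [h.supp i j hij, (principalMinor_pos (h.posDef hG) _).ne']

theorem condCov_phi_two (hG : IsDAG G) (h : IsParam G (fun _ => 1) Λ) (K : Finset V) (i j : V) :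
    condCov (phi (fun _ => 2) Λ) K i j = 2 * condCov (phi (fun _ => 1) Λ) K i j := by
  have h2 : IsParam G (fun _ => 2) Λ := ⟨fun _ => two_pos, h.supp⟩
  have e : ∀ u v, phi (fun _ => 2) Λ u v = 2 * phi (fun _ => 1) Λ u v := fun u v => by
    rw [phi_apply, phi_apply, Finset.mul_sum]
    exact Finset.sum_congr rfl fun w _ => by ring
  obtain ⟨b, hb⟩ := exists_regression (h.posDef hG) K i
  have hsum : ∀ k, ∑ l ∈ K, b l * phi (fun _ => 2) Λ l k =
      2 * ∑ l ∈ K, b l * phi (fun _ => 1) Λ l k := fun k => by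
    rw [Finset.mul_sum]
    exact Finset.sum_congr rfl fun l _ => by rw [e]; ring
  rw [condCov_eq (h.posDef hG) hb, condCov_eq (h2.posDef hG) (b := b), hsum, e]
  · ring
  · intro k hk
    rw [hsum, e, hb k hk]

/-- For i ∉ A, `lambdaFun` is a conditional covariance. It doubles with the error variances, whereas
the coefficient 1 of the edge is unchanged. -/
theorem mem_of_forall_lambdaFun (hG : IsDAG G) (hij : G.Adj i j)
    (H : ∀ (ω : V → ℝ) (Λ : Matrix V V ℝ), IsParam G ω Λ → Λ i j = lambdaFun i j A (phi ω Λ)) :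
    i ∈ A := by
  by_contra hi
  have h : IsParam G (fun _ => 1) ((0 : Matrix V V ℝ).updateCol j (Pi.single i 1)) :=
    (isParam_of_pos fun _ => one_pos).updateCol_single hij
  have h1 := H _ _ h
  have h2 := H _ _ (⟨fun _ => two_pos, h.supp⟩ : IsParam G (fun _ => 2) _)
  rw [lambdaFun_of_notMem hi, updateCol_self, Pi.single_eq_same] at h1 h2
  rw [condCov_phi_two hG h, ← h1] at h2
  norm_num at h2

theorem notMem_deBar_of_forall_lambdaFun (hG : IsDAG G) (hij : G.Adj i j)
    (H : ∀ (ω : V → ℝ) (Λ : Matrix V V ℝ), IsParam G ω Λ → Λ i j = lambdaFun i j A (phi ω Λ)) :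
    ∀ d ∈ A, d ∉ deBar G j := by
  have hi := mem_of_forall_lambdaFun hG hij H
  have hf : ∀ u, ¬ G.Adj u j → (Pi.single i 1 : V → ℝ) u = 0 := fun u hu =>
    Pi.single_eq_of_ne (by rintro rfl; exact hu hij) _
  by_contra! hcon
  obtain ⟨d, hd, hdj, hmin⟩ := exists_min_depth hcon
  have hid : i ≠ d := by rintro rfl; exact notMem_deBar_of_adj hG hij hdj
  obtain ⟨Λ, P, h, hΛ, hjP, hdP, hPj, hPd, h1, hk, hjj, hdj', hdd⟩ := exists_pathCov hG hf hdj
  have hiP : i ∉ P := fun hiP => notMem_deBar_of_adj hG hij (hPj i hiP)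
  have hAP : ∀ k ∈ A, k ≠ d → k ∉ P := fun k hkA hkd hkP =>
    absurd (hPd k hkP hkd) (not_lt.2 (hmin k hkA (hPj k hkP)))
  have hcard : (0 : ℝ) < P.card := by exact_mod_cast Finset.card_pos.2 ⟨j, hjP⟩
  have hsq : ∑ u, (Pi.single i 1 : V → ℝ) u ^ 2 = 1 := by simp [Pi.single_apply]
  rw [hsq] at hjj hdj' hdd
  -- With ε the errors, X_i = ε_i, X_j = ε_i + ε_j, and X_d − X_i is the sum of the errors on P. So
  -- the regression of X_j on A is X_i + (X_d − X_i)/|P|. The coefficient of i is 1 − 1/|P|, not 1.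
  have hsum : ∀ k, ∑ l ∈ A, (Pi.single i (1 - 1 / P.card : ℝ) + Pi.single d (1 / P.card : ℝ) :
      V → ℝ) l * phi (fun _ => 1) Λ k l =
      (1 - 1 / P.card) * phi (fun _ => 1) Λ k i + 1 / P.card * phi (fun _ => 1) Λ k d := by
    intro k
    simp only [Pi.add_apply, add_mul, Finset.sum_add_distrib]
    congr 1
    · rw [Finset.sum_eq_single i]
      · rw [Pi.single_eq_same]
      · intro l _ hl
        rw [Pi.single_eq_of_ne hl, zero_mul]
      · exact fun h => absurd hi h
    · rw [Finset.sum_eq_single d]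
      · rw [Pi.single_eq_same]
      · intro l _ hl
        rw [Pi.single_eq_of_ne hl, zero_mul]
      · exact fun h => absurd hd h
  have := H _ _ h
  rw [lambdaFun_eq_of_regression (h.posDef hG) hi
    (b := Pi.single i (1 - 1 / P.card : ℝ) + Pi.single d (1 / P.card : ℝ)), hΛ] at this
  · have hinv := inv_pos.2 hcard
    simp [hid] at this
    linarith
  · intro k hkA
    rw [hsum]
    by_cases hkd : k = d
    · subst hkd
      rw [hdj', hdd, phi_comm k i, (hk i hiP).2, Pi.single_eq_same]
      field_simp
      ring
    · have hkP := hAP k hkA hkd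
      rw [(hk k hkP).1, (hk k hkP).2, h1 k hkP i hiP, one_apply, Pi.single_apply]
      ring

end Identification

/-! ### The edge case: deleting the edge and the descendants of its head -/

section Deletion

/-- The graph on `V` with the edges of a graph on a subtype of `V`. -/
def extend {V : Type*} {p : V → Prop} (H : Digraph {v // p v}) : Digraph V where
  Adj a b := ∃ ha hb, H.Adj ⟨a, ha⟩ ⟨b, hb⟩

theorem ball_extend_iff {V : Type*} {p : V → Prop} {H : Digraph {v // p v}} {K : Set V}
    {a b : {v // p v}} {d : Bool} :
    Ball (extend H) K a b d ↔ Ball H (Subtype.val ⁻¹' K) a b d := by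
  constructor
  · suffices ∀ v d, Ball (extend H) K a v d → ∃ hv : p v, Ball H (Subtype.val ⁻¹' K) a ⟨v, hv⟩ d by
      intro h
      exact (this _ _ h).2
    intro v d h
    induction h with
    | start => exact ⟨a.2, .start⟩
    | child _ hv hw ih => exact ⟨hw.2.1, ih.2.child hv hw.2.2⟩
    | parent _ hv hw ih => exact ⟨hw.1, ih.2.parent hv hw.2.2⟩
  · intro h
    induction h with
    | start => exact .start
    | child _ hv hw ih => exact ih.child hv ⟨_, _, hw⟩
    | parent _ hv hw ih => exact ih.parent hv ⟨_, _, hw⟩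

variable {V : Type*} [Fintype V] [DecidableEq V] {G : Digraph V} {ω : V → ℝ} {Λ : Matrix V V ℝ}
  {A : Finset V} {i j : V}

theorem isDAG_edgeDeleted (hG : IsDAG G) (i j : V) : IsDAG (edgeDeleted G i j) :=
  fun v hv => hG v (Relation.TransGen.lift Subtype.val (fun _ _ h => h.1) _ _ hv)

theorem adj_of_extend_edgeDeleted {a b : V} (h : (extend (edgeDeleted G i j)).Adj a b) :
    G.Adj a b :=
  h.2.2.1

/-- The edge-deleted graph lives on a subtype. Its Bayes ball is that of its extension to V, where
the deleted vertices are isolated, so `dep_iff_conn` can be applied on V. -/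
theorem dSeparates_edgeDeleted_iff (hG : IsDAG G) (hij : G.Adj i j) (A : Finset V) :
    DSeparates (edgeDeleted G i j) (Subtype.val ⁻¹' ((A : Set V) \ {i}))
        {⟨i, tail_notMem_de hG hij⟩} {⟨j, self_notMem_de hG j⟩} ↔
      ¬ Dep (extend (edgeDeleted G i j)) (A.erase i) i j := by
  have hG' : IsDAG (extend (edgeDeleted G i j)) := hG.mono fun _ _ => adj_of_extend_edgeDeleted
  rw [dSeparates_iff_not_conn (isDAG_edgeDeleted hG i j) (by simp), dep_comm hG',
    dep_iff_conn hG', Conn, Conn, Finset.coe_erase]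
  simp only [← ball_extend_iff, Set.mem_preimage]

/-- Outside `deBar G j` both parameters give the same covariances. The structural equations of j
differ there only by the term of i, which contributes exactly Λ i j to the regression coefficient.
-/
theorem IsParam.lambdaFun_eq_of_edgeDeleted (hG : IsDAG G) (h : IsParam G ω Λ)
    (hi : i ∈ A) (hA : ∀ k ∈ A, k ∉ deBar G j) {Λ' : Matrix V V ℝ}
    (h' : IsParam (extend (edgeDeleted G i j)) ω Λ')
    (hΛ : ∀ u v, (extend (edgeDeleted G i j)).Adj u v → Λ' u v = Λ u v) :
    lambdaFun i j A (phi ω Λ) = Λ i j +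
      condCov (phi ω Λ') (A.erase i) i j / condCov (phi ω Λ) (A.erase i) i i := by
  have hG' : IsDAG (extend (edgeDeleted G i j)) := hG.mono fun _ _ => adj_of_extend_edgeDeleted
  have h'' : IsParam G ω Λ' := h'.mono fun _ _ => adj_of_extend_edgeDeleted
  have hde : ∀ {v}, v ∉ deBar G j → v ∉ de G j := fun hv h => hv (Or.inr h)
  have hanc : ∀ u v, G.Adj u v → v ∈ (deBar G j)ᶜ → u ∈ (deBar G j)ᶜ := fun u v huv hv hu =>
    hv (Or.inr (mem_deBar_of_adj hu huv))
  have hpa : ∀ u v, G.Adj u v → v ∉ de G j → ¬ (u = i ∧ v = j) →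
      (extend (edgeDeleted G i j)).Adj u v := fun u v huv hv hne =>
    ⟨fun hu => hv (hu.tail huv), hv, huv, hne⟩
  have hcongr : ∀ p, p ∉ deBar G j → condCov (phi ω Λ') (A.erase i) i p =
      condCov (phi ω Λ) (A.erase i) i p := by
    intro p hp
    have hmem : ∀ u ∈ insert i (insert p (A.erase i)), u ∈ (deBar G j)ᶜ := by
      intro u hu
      simp only [Finset.mem_insert, Finset.mem_erase] at hu
      rcases hu with rfl | rfl | hu
      · exact hA _ hi
      · exact hp
      · exact hA _ hu.2
    refine condCov_congr fun u hu v hv => phi_congr hG h'' h hanc (fun _ _ => rfl) ?_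
      (hmem u hu) (hmem v hv)
    intro v hv u
    by_cases huv : G.Adj u v
    · exact hΛ u v (hpa u v huv (hde hv) fun hc => hv (hc.2 ▸ self_mem_deBar))
    · rw [h.supp u v huv, h''.supp u v huv]
  have hlin : ∀ {Λ : Matrix V V ℝ}, IsParam G ω Λ → condCov (phi ω Λ) (A.erase i) i j =
      ∑ p, Λ p j * condCov (phi ω Λ) (A.erase i) i p := fun {Λ} h =>
    condCov_linear_right (h.posDef hG) Finset.univ (fun p => Λ p j) id fun v hv =>
      h.phi_apply_nondescendant hG (hA v (by rwa [Finset.insert_erase hi] at hv))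
  have hsplit : condCov (phi ω Λ) (A.erase i) i j = condCov (phi ω Λ') (A.erase i) i j +
      Λ i j * condCov (phi ω Λ) (A.erase i) i i := by
    rw [hlin h, hlin h'', ← Finset.add_sum_erase _ _ (Finset.mem_univ i),
      ← Finset.add_sum_erase _ (fun p => Λ' p j * _) (Finset.mem_univ i),
      h'.supp i j fun hc => hc.2.2.2 ⟨rfl, rfl⟩, zero_mul, zero_add, add_comm]
    congr 1
    refine Finset.sum_congr rfl fun p hp => ?_
    have hpi := Finset.ne_of_mem_erase hp
    by_cases hpj : G.Adj p j
    · rw [hcongr p (notMem_deBar_of_adj hG hpj),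
        hΛ p j (hpa p j hpj (self_notMem_de hG j) fun hc => hpi hc.1)]
    · rw [h.supp p j hpj, h''.supp p j hpj, zero_mul, zero_mul]
  have hpos := condCov_self_pos (h.posDef hG) (K := A.erase i) (i := i) (by simp)
  rw [lambdaFun_of_mem (h.posDef hG) hi, hsplit, add_div, mul_div_cancel_right₀ _ hpos.ne',
    add_comm]

/-- Parameters of the edge-deleted graph are parameters of G, and conversely those of G restrict to
it; in both directions the error term of `IsParam.lambdaFun_eq_of_edgeDeleted` decides. -/
theorem forall_lambdaFun_iff_not_dep (hG : IsDAG G) (hi : i ∈ A)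
    (hA : ∀ k ∈ A, k ∉ deBar G j) :
    (∀ (ω : V → ℝ) (Λ : Matrix V V ℝ), IsParam G ω Λ → Λ i j = lambdaFun i j A (phi ω Λ)) ↔
      ¬ Dep (extend (edgeDeleted G i j)) (A.erase i) i j := by
  classical
  constructor
  · rintro H ⟨ω, Λ, h, hc⟩
    have h' : IsParam G ω Λ := h.mono fun _ _ => adj_of_extend_edgeDeleted
    have := H ω Λ h'
    rw [h'.lambdaFun_eq_of_edgeDeleted hG hi hA h fun _ _ _ => rfl, left_eq_add] at this
    exact div_ne_zero hc (condCov_self_pos (h'.posDef hG) (by simp)).ne' this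
  · intro H ω Λ h
    have h' : IsParam (extend (edgeDeleted G i j)) ω
        (Matrix.of fun u v => if (extend (edgeDeleted G i j)).Adj u v then Λ u v else 0) :=
      ⟨h.pos, fun u v huv => by simp [huv]⟩
    rw [h.lambdaFun_eq_of_edgeDeleted hG hi hA h' fun u v huv => by simp [huv], left_eq_add,
      div_eq_zero_iff]
    left
    by_contra hc
    exact H ⟨_, _, h', hc⟩

end Deletion

end GaussianDAG

theorem mainTheorem7 {V : Type*} [Fintype V] [DecidableEq V] (G : Digraph V)
    (hG : GaussianDAG.IsDAG G) :
    -- vertex case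
    (∀ (i : V) (A : Finset V),
      (∀ (ω : V → ℝ) (Λ : Matrix V V ℝ), GaussianDAG.IsParam G ω Λ →
        ω i = GaussianDAG.omegaFun i A (GaussianDAG.phi ω Λ)) ↔
      (GaussianDAG.pa G i ⊆ (A : Set V) ∧ (A : Set V) ⊆ Set.univ \ GaussianDAG.deBar G i)) ∧
    -- non-edge case
    (∀ (i j : V) (A : Finset V), ¬ G.Adj i j →
      ((∀ (ω : V → ℝ) (Λ : Matrix V V ℝ), GaussianDAG.IsParam G ω Λ →
        Λ i j = 0 ∧ 0 = GaussianDAG.lambdaFun i j A (GaussianDAG.phi ω Λ)) ↔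
      GaussianDAG.DSeparates G ((A : Set V) \ {i}) {i} {j})) ∧
    -- edge case
    (∀ (i j : V) (A : Finset V) (hij : G.Adj i j),
      (∀ (ω : V → ℝ) (Λ : Matrix V V ℝ), GaussianDAG.IsParam G ω Λ →
        Λ i j = GaussianDAG.lambdaFun i j A (GaussianDAG.phi ω Λ)) ↔
      (i ∈ A ∧ (A : Set V) ⊆ Set.univ \ GaussianDAG.deBar G j ∧
        GaussianDAG.DSeparates (GaussianDAG.edgeDeleted G i j)
          (Subtype.val ⁻¹' ((A : Set V) \ {i}))
          {⟨i, GaussianDAG.tail_notMem_de hG hij⟩}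
          {⟨j, GaussianDAG.self_notMem_de hG j⟩})) := by
  refine ⟨GaussianDAG.forall_omegaFun_iff hG,
    fun i j A hij => GaussianDAG.forall_lambdaFun_eq_zero_iff hG hij A, fun i j A hij => ?_⟩
  rw [GaussianDAG.dSeparates_edgeDeleted_iff hG hij]
  constructor
  · intro H
    have hi := GaussianDAG.mem_of_forall_lambdaFun hG hij H
    have hA := GaussianDAG.notMem_deBar_of_forall_lambdaFun hG hij H
    exact ⟨hi, fun k hk => ⟨trivial, hA k hk⟩,
      (GaussianDAG.forall_lambdaFun_iff_not_dep hG hi hA).1 H⟩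
  · rintro ⟨hi, hA, H⟩
    exact (GaussianDAG.forall_lambdaFun_iff_not_dep hG hi fun k hk => (hA hk).2).2 H
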